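/- Let $X$ be a Banach space, $A:[0,\infty)\to\mathcal B(X)$ continuous, and $T(t,s)$, $t,s\ge 0$, the evolution operator of $x'=A(t)x$. A growth rate is a nondecreasing function $u:[0,\infty)\to(0,\infty)$ with $u(0)=1$ and $u(t)\to\infty$ as $t\to\infty$. Let $h,k,\mu,\nu$ be growth rates and let $a<0\le b$, $\varepsilon\ge 0$, $K>0$, $q>0$. Assume: (c$_1$) $x'=A(t)x$ has a nonuniform $(h,k,\mu,\nu)$-dichotomy on $\mathbb R^+$: there are bounded projections $P(t)$, $t\ge0$, with complementary projections $Q(t)=\mathrm{id}-P(t)$, such that $P(t)T(t,s)=T(t,s)P(s)$ for $t,s\ge0$, $$\|T(t,s)P(s)\|\le K\Big(\frac{h(t)}{h(s)}\Big)^a\mu(s)^\varepsilon\ (t\ge s\ge0),\qquad \|T(t,s)Q(s)\|\le K\Big(\frac{k(s)}{k(t)}\Big)^{-b}\nu(s)^\varepsilon\ (s\ge t\ge 0).$$ (c$_2$) $\lim_{t\to\infty}k(t)^{-b}h(t)^a\nu(t)^\varepsilon=0$. (c$_3$) The integral $C(t)=\int_t^\infty h(\tau)^{aq}\max\{\mu(\tau)^\varepsilon,\nu(\tau)^\varepsilon\}\,d\tau$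 is finite, and $h(t)^a\beta(t)^\varepsilon$ is nonincreasing on $[0,\infty)$, where $$\beta(t)^\varepsilon=k(t)^{b/q}h(t)^{-a(q+1)/q}\mu(t)^{\varepsilon(1+1/q)}C(t)^{1/q}.$$ Put $E(t)=P(t)X$, $F(t)=Q(t)X$, $Z_\beta=\{(s,\xi): s\ge0,\ \xi\in E(s),\ \|\xi\|<\beta(s)^{-\varepsilon}\}$ and $Z_{\beta\mu}(2K)=\{(s,\xi): s\ge0,\ \xi\in E(s),\ \|\xi\|<(2K)^{-1}\beta(s)^{-\varepsilon}\mu(s)^{-\varepsilon}\}$. Let $\mathcal X$ be the set of continuous $\Phi:Z_\beta\to X$ with $\Phi(s,0)=0$, $\Phi(s,\xi)\in F(s)$ and $\|\Phi(s,\xi_1)-\Phi(s,\xi_2)\|\le\|\xi_1-\xi_2\|$. Then there is $c_0>0$ such that the following holds for every open subset $Y$ of a Banach space, every $\hat c\in(0,c_0]$ and every $f:[0,\infty)\times X\times Y\to X$ which is continuous in $t$, satisfies $f(t,0,\lambda)=0$ and, for all $t\ge 0$, $x,x_1,x_2\in X$, $\lambda,\lambda_1,\lambda_2\in Y$, $$\|f(t,x_1,\lambda)-f(t,x_2,\lambda)\|\le\hat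 c\|x_1-x_2\|(\|x_1\|^q+\|x_2\|^q),\qquad \|f(t,x,\lambda_1)-f(t,x,\lambda_2)\|\le\hat c|\lambda_1-\lambda_2|\,\|x\|^{q+1}.$$ Let $\Psi^\lambda_\kappa(s,u(s),v(s))=(t,u(t),v(t))$, $t=s+\kappa$, $\kappa\ge0$, be the semiflow on $\{(s,u,v): s\ge 0,\,u\in E(s),\,v\in F(s)\}$ given by $$u(t)=T(t,s)u(s)+\int_s^tT(t,\tau)P(\tau)f(\tau,u(\tau)+v(\tau),\lambda)\,d\tau,\quad v(t)=T(t,s)v(s)+\int_s^tT(t,\tau)Q(\tau)f(\tau,u(\tau)+v(\tau),\lambda)\,d\tau$$ wherever the solution exists. (d$_1$) For each $\lambda\in Y$ there is $\Phi^\lambda\in\mathcal X$ whose graph $\mathcal W^\lambda=\{(s,\xi,\Phi^\lambda(s,\xi)):(s,\xi)\in Z_\beta\}$ is forward invariant in the sense that $\Psi^\lambda_\kappa(s,\xi,\Phi^\lambda(s,\xi))$ is defined and lies in $\mathcal W^\lambda$ for all $(s,\xi)\in Z_{\beta\mu}(2K)$ and $\kappa\ge0$. It is unique over $Z_{\beta\mu}(2K)$: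 every $\Phi\in\mathcal X$ whose graph is forward invariant in this sense coincides with $\Phi^\lambda$ on $Z_{\beta\mu}(2K)$. (d$_2$) There is $d>0$ such that for all $\lambda\in Y$, $(s,\xi_1),(s,\xi_2)\in Z_{\beta\mu}(2K)$ and $t=s+\kappa\ge s$, $$\|\Psi^\lambda_\kappa(s,\xi_1,\Phi^\lambda(s,\xi_1))-\Psi^\lambda_\kappa(s,\xi_2,\Phi^\lambda(s,\xi_2))\|\le d\Big(\frac{h(t)}{h(s)}\Big)^a\mu(s)^\varepsilon\|\xi_1-\xi_2\|.$$ (d$_3$) There is $d^*>0$ such that for all $\lambda_1,\lambda_2\in Y$, $(s,\xi)\in Z_{\beta\mu}(2K)$ and $t=s+\kappa\ge s$, $$\|\Psi^{\lambda_1}_\kappa(s,\xi,\Phi^{\lambda_1}(s,\xi))-\Psi^{\lambda_2}_\kappa(s,\xi,\Phi^{\lambda_2}(s,\xi))\|\le d^*\Big(\frac{h(t)}{h(s)}\Big)^a\mu(s)^\varepsilon|\lambda_1-\lambda_2|\,\|\xi\|.$$ -/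

import Mathlib

open Set Filter Topology MeasureTheory

noncomputable section

namespace StableManifold

variable {X : Type*} [NormedAddCommGroup X] [NormedSpace ℝ X]

/-- Growth rate on the half-line: a nondecreasing positive function on `[0, ∞)` with value `1` at
`0` and limit `∞` at `∞`. (The restriction to `[0, ∞)` of a growth rate on `ℝ`.) -/
structure IsGrowthRate (u : ℝ → ℝ) : Prop where
  monotoneOn : MonotoneOn u (Ici 0)
  pos : ∀ t, 0 ≤ t → 0 < u t
  map_zero : u 0 = 1
  tendsto_atTop : Tendsto u atTop atTop

/-- `T` is the evolution operator on `[0, ∞)` of the linear equation `x' = A(t) x`: for each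
`s ≥ 0`, the function `t ↦ T(t,s)` is the solution of `Z' = A(t) Z`, `Z(s) = id`
(forwards and backwards in time). -/
structure IsEvolutionOperator (A : ℝ → X →L[ℝ] X) (T : ℝ → ℝ → X →L[ℝ] X) : Prop where
  self : ∀ s, 0 ≤ s → T s s = ContinuousLinearMap.id ℝ X
  hasDeriv : ∀ s, 0 ≤ s → ∀ t, 0 ≤ t →
    HasDerivWithinAt (fun r => T r s) ((A t).comp (T t s)) (Ici 0) t

/-- The complementary projection `Q(t) = id - P(t)`. -/
def compl (P : ℝ → X →L[ℝ] X) (t : ℝ) : X →L[ℝ] X := ContinuousLinearMap.id ℝ X - P t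

/-- Nonuniform `(h,k,μ,ν)`-dichotomy on `[0, ∞)` of the equation with evolution operator `T`, with
projections `P(t)` and constants `a < 0 ≤ b`, `ε ≥ 0`, `K > 0`. -/
structure IsDichotomy (T : ℝ → ℝ → X →L[ℝ] X) (P : ℝ → X →L[ℝ] X)
    (h k μ ν : ℝ → ℝ) (a b ε K : ℝ) : Prop where
  a_neg : a < 0
  b_nonneg : 0 ≤ b
  ε_nonneg : 0 ≤ ε
  K_pos : 0 < K
  proj : ∀ t, 0 ≤ t → (P t).comp (P t) = P t
  comm : ∀ t s, 0 ≤ t → 0 ≤ s → (P t).comp (T t s) = (T t s).comp (P s)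
  stable : ∀ t s, 0 ≤ s → s ≤ t →
    ‖(T t s).comp (P s)‖ ≤ K * (h t / h s) ^ a * μ |s| ^ ε
  unstable : ∀ t s, 0 ≤ t → t ≤ s →
    ‖(T t s).comp (compl P s)‖ ≤ K * (k s / k t) ^ (-b) * ν |s| ^ ε

/-- The stable space `E(t) = P(t)(X)`. -/
def stableSpace (P : ℝ → X →L[ℝ] X) (t : ℝ) : Set X := range (P t)

/-- The unstable space `F(t) = Q(t)(X)`. -/
def unstableSpace (P : ℝ → X →L[ℝ] X) (t : ℝ) : Set X := range (compl P t)

/-- The integrand `h(τ)^{aq} max{μ(τ)^ε, ν(τ)^ε}` of `C(t)`. -/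
def tailIntegrand (h μ ν : ℝ → ℝ) (a ε q : ℝ) (τ : ℝ) : ℝ :=
  h τ ^ (a * q) * max (μ τ ^ ε) (ν τ ^ ε)

/-- `C(t) = ∫_t^∞ h(τ)^{aq} max{μ(τ)^ε, ν(τ)^ε} dτ`. -/
def tailC (h μ ν : ℝ → ℝ) (a ε q t : ℝ) : ℝ :=
  ∫ τ in Ioi t, tailIntegrand h μ ν a ε q τ

/-- The function `β(t) = k^{b/(εq)} h^{-a(q+1)/(εq)} μ^{1+1/q} C^{1/(εq)}` (meaningful for
`ε > 0`). It only ever enters through its power `β(t)^ε`. -/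
def beta (h k μ ν : ℝ → ℝ) (a b ε q t : ℝ) : ℝ :=
  k t ^ (b / (ε * q)) * h t ^ (-a * (q + 1) / (ε * q)) * μ t ^ (1 + 1 / q)
    * tailC h μ ν a ε q t ^ (1 / (ε * q))

/-- The function `β(t)^ε = k^{b/q} h^{-a(q+1)/q} μ^{ε(1+1/q)} C^{1/q}`, which makes sense for
`ε = 0` as well. -/
def betaPow (h k μ ν : ℝ → ℝ) (a b ε q t : ℝ) : ℝ :=
  k t ^ (b / q) * h t ^ (-a * (q + 1) / q) * μ t ^ (ε * (1 + 1 / q))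
    * tailC h μ ν a ε q t ^ (1 / q)

theorem tailC_nonneg {h μ ν : ℝ → ℝ} {a ε q t : ℝ} (hh : IsGrowthRate h)
    (hμ : IsGrowthRate μ) (ht : 0 ≤ t) : 0 ≤ tailC h μ ν a ε q t := by
  refine setIntegral_nonneg measurableSet_Ioi fun τ hτ => ?_
  have hτ0 : 0 ≤ τ := ht.trans (le_of_lt hτ)
  exact mul_nonneg (Real.rpow_nonneg (hh.pos τ hτ0).le _)
    (le_max_of_le_left (Real.rpow_nonneg (hμ.pos τ hτ0).le _))

theorem beta_rpow {h k μ ν : ℝ → ℝ} {a b ε q t : ℝ} (hh : IsGrowthRate h)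
    (hk : IsGrowthRate k) (hμ : IsGrowthRate μ) (hε : 0 < ε) (ht : 0 ≤ t) :
    beta h k μ ν a b ε q t ^ ε = betaPow h k μ ν a b ε q t := by
  have h1 := (hh.pos t ht).le
  have h2 := (hk.pos t ht).le
  have h3 := (hμ.pos t ht).le
  have h4 := tailC_nonneg (ν := ν) (a := a) (ε := ε) (q := q) hh hμ ht
  have key : ∀ x : ℝ, x / (ε * q) * ε = x / q := by
    intro x
    rw [div_mul_eq_mul_div, mul_comm x ε, mul_div_mul_left _ _ hε.ne']
  unfold beta betaPow
  rw [Real.mul_rpow (by positivity) (by positivity), Real.mul_rpow (by positivity) (by positivity),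
    Real.mul_rpow (by positivity) (by positivity), ← Real.rpow_mul h1, ← Real.rpow_mul h2,
    ← Real.rpow_mul h3, ← Real.rpow_mul h4, key, key, key, mul_comm (1 + 1 / q) ε]

/-- The bundle `{(s, ξ) : s ≥ 0, ξ ∈ E(s), ‖ξ‖ < ρ(s)}` of open balls in the stable spaces. -/
def ballBundle (P : ℝ → X →L[ℝ] X) (ρ : ℝ → ℝ) : Set (ℝ × X) :=
  {p | 0 ≤ p.1 ∧ p.2 ∈ stableSpace P p.1 ∧ ‖p.2‖ < ρ p.1}

/-- `Z_β = Z_β(1)`: the balls have radius `β(s)^{-ε}`. -/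
def ZBeta (P : ℝ → X →L[ℝ] X) (h k μ ν : ℝ → ℝ) (a b ε q : ℝ) : Set (ℝ × X) :=
  ballBundle P fun s => (betaPow h k μ ν a b ε q s)⁻¹

/-- `Z_{β·μ}(η)`: the balls have radius `(β(s) μ(s))^{-ε} / η`. -/
def ZBetaMu (P : ℝ → X →L[ℝ] X) (h k μ ν : ℝ → ℝ) (a b ε q η : ℝ) : Set (ℝ × X) :=
  ballBundle P fun s => (betaPow h k μ ν a b ε q s * μ s ^ ε)⁻¹ / η

/-- The class of functions `Φ` on `Z ⊆ ℝ × X` that are continuous, vanish at the centres `(s, 0)`,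
take values `Φ(s, ξ) ∈ F(s)` and are `1`-Lipschitz in `ξ`. Values of `Φ` off `Z` play no role. -/
structure IsGraphFunction (P : ℝ → X →L[ℝ] X) (Z : Set (ℝ × X)) (Φ : ℝ → X → X) : Prop where
  continuousOn : ContinuousOn (fun p : ℝ × X => Φ p.1 p.2) Z
  map_zero : ∀ s, 0 ≤ s → Φ s 0 = 0
  mem_unstable : ∀ s ξ, (s, ξ) ∈ Z → Φ s ξ ∈ unstableSpace P s
  lipschitz : ∀ s ξ₁ ξ₂, (s, ξ₁) ∈ Z → (s, ξ₂) ∈ Z → ‖Φ s ξ₁ - Φ s ξ₂‖ ≤ ‖ξ₁ - ξ₂‖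

/-- The graph `{(s, ξ, Φ(s, ξ)) : (s, ξ) ∈ Z}`. -/
def graphOver (Z : Set (ℝ × X)) (Φ : ℝ → X → X) : Set (ℝ × X × X) :=
  {p | (p.1, p.2.1) ∈ Z ∧ p.2.2 = Φ p.1 p.2.1}

/-- `(u, v)` solves on `[s, t]` the equation `x' = A(r) x + g(r, x)`, `x = u + v`, split along
`E(r) ⊕ F(r)`, in its variation-of-constants form. -/
structure IsSplitSolution (T : ℝ → ℝ → X →L[ℝ] X) (P : ℝ → X →L[ℝ] X) (g : ℝ → X → X)
    (s t : ℝ) (u v : ℝ → X) : Prop where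
  continuousOn_u : ContinuousOn u (Icc s t)
  continuousOn_v : ContinuousOn v (Icc s t)
  mem_stable : ∀ r ∈ Icc s t, u r ∈ stableSpace P r
  mem_unstable : ∀ r ∈ Icc s t, v r ∈ unstableSpace P r
  eq_u : ∀ r ∈ Icc s t, u r = T r s (u s) + ∫ τ in s..r, T r τ (P τ (g τ (u τ + v τ)))
  eq_v : ∀ r ∈ Icc s t, v r = T r s (v s) + ∫ τ in s..r, T r τ (compl P τ (g τ (u τ + v τ)))

/-- The semiflow `Ψ_κ` generated by `x' = A(t) x + g(t, x)`, as a relation because solutions need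
not exist for all time: `Semiflow T P g κ p p'` says that `Ψ_κ(p)` is defined and equal to `p'`.
Here `p = (s, u(s), v(s))` and `p' = (t, u(t), v(t))` with `t = s + κ`. -/
def Semiflow (T : ℝ → ℝ → X →L[ℝ] X) (P : ℝ → X →L[ℝ] X) (g : ℝ → X → X) (κ : ℝ)
    (p p' : ℝ × X × X) : Prop :=
  0 ≤ κ ∧ 0 ≤ p.1 ∧ ∃ u v : ℝ → X, IsSplitSolution T P g p.1 (p.1 + κ) u v ∧
    p = (p.1, u p.1, v p.1) ∧ p' = (p.1 + κ, u (p.1 + κ), v (p.1 + κ))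

/-- Forward invariance of the graph of `Φ` over `Z`, for initial conditions over `Z'`:
for `(s, ξ) ∈ Z'` and `κ ≥ 0`, the point `Ψ_κ(s, ξ, Φ(s, ξ))` is defined and in the graph. -/
def IsForwardInvariant (T : ℝ → ℝ → X →L[ℝ] X) (P : ℝ → X →L[ℝ] X) (g : ℝ → X → X)
    (Z Z' : Set (ℝ × X)) (Φ : ℝ → X → X) : Prop :=
  ∀ s ξ, (s, ξ) ∈ Z' → ∀ κ, 0 ≤ κ →
    ∃ p', Semiflow T P g κ (s, ξ, Φ s ξ) p' ∧ p' ∈ graphOver Z Φ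

/-- The conditions on the perturbation `f(t, x, λ)`, `t ≥ 0`, `x ∈ X`, `λ ∈ Y`: continuity in `t`,
`f(t, 0, λ) = 0` and the two Lipschitz-type bounds with constants `c` and `q`. -/
structure IsPerturbation {V : Type*} [NormedAddCommGroup V]
    (Y : Set V) (f : ℝ → X → V → X) (c q : ℝ) : Prop where
  continuousOn : ∀ x, ∀ lam ∈ Y, ContinuousOn (fun t => f t x lam) (Ici 0)
  map_zero : ∀ t, 0 ≤ t → ∀ lam ∈ Y, f t 0 lam = 0
  lipschitz : ∀ t, 0 ≤ t → ∀ x₁ x₂, ∀ lam ∈ Y,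
    ‖f t x₁ lam - f t x₂ lam‖ ≤ c * ‖x₁ - x₂‖ * (‖x₁‖ ^ q + ‖x₂‖ ^ q)
  lipschitz_param : ∀ t, 0 ≤ t → ∀ x, ∀ lam₁ ∈ Y, ∀ lam₂ ∈ Y,
    ‖f t x lam₁ - f t x lam₂‖ ≤ c * ‖lam₁ - lam₂‖ * ‖x‖ ^ (q + 1)

end StableManifold

end

/-!
The proof is by the Lyapunov–Perron method, without a graph transform. Over each point `(s, ξ)` of
`Z_β` there is exactly one small mild solution `x` of `x' = A(t) x + f(t, x, λ)` on `[s, ∞)` that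
decays like `h(t)^a` and has `P(s) x(s) = ξ`, and `Φ^λ(s, ξ)` is its unstable component `Q(s) x(s)`.

*Linear part.* A mild solution `x` with forcing `G` splits along `P` and `Q`. If `x = O(h^a)`, its
unstable component at time `t`, pulled back from a later time `r`, contributes
`k(r)^{-b} ν(r)^ε h(r)^a → 0`, so `Q(t) x(t)` is determined by the forcing after time `t`. Together
with the stable bound this controls `x` by `P(s) x(s)` and by the size of `G`, at the price of one
factor `C(s)` (`IsAdmissible.norm_proj_le`, `IsAdmissible.norm_compl_le`). As the notion of mild
solution is linear in `(x, G)`, the same estimates compare two solutions.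

*Nonlinear part.* Among functions of size `N h^a` the nonlinearity has Lipschitz constant
`2 c N^q h^{aq}`, so the smallness condition is a bound on `c N^q C(s)`. The function `β` is defined
so that, for the weighted size `N = radius s` of linear solutions issued from `Z_β`, the quantity
`N^q C(s) μ(s)^ε` is bounded uniformly in `s` (`IsAdmissible.radius_rpow_mul_le`). This gives
existence by contraction (`IsAdmissible.exists_isDecaying`) and comparison of solutions, for equal or
different parameters (`IsAdmissible.norm_sub_le_of_isDecaying`); the latter yields uniqueness, the
Lipschitz property of `Φ^λ` and both estimates along the semiflow. Because `C` is nonincreasing, a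
decaying solution restricted to a later half-line stays in the uniqueness class, and because
`h^a β^ε` is nonincreasing its stable component stays over `Z_β`: the graph is forward invariant.

*Uniqueness of the graph.* Along an invariant graph of a `1`-Lipschitz function one has
`‖x‖ ≤ 2 ‖P x‖`, and a nonlinear Gronwall argument (`IsAdmissible.norm_proj_le_of_dominated`) shows
that `x` decays like `h^a` within the uniqueness class. Hence it is the solution defining `Φ^λ`.
-/

noncomputable section

namespace StableManifold

variable {X : Type*} [NormedAddCommGroup X] [NormedSpace ℝ X]

/-! ### Evolution families -/

/-- An invertible evolution family on `[0, ∞)` that is continuous in each of its two times, based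
at `0`. By the cocycle identity `T(t,s) = T(t,0) T(0,s)` this is joint norm continuity. -/
structure IsEvolutionFamily (T : ℝ → ℝ → X →L[ℝ] X) : Prop where
  self : ∀ s, 0 ≤ s → T s s = ContinuousLinearMap.id ℝ X
  comp : ∀ t r s, 0 ≤ t → 0 ≤ r → 0 ≤ s → (T t r).comp (T r s) = T t s
  continuousOn_left : ContinuousOn (fun t => T t 0) (Ici 0)
  continuousOn_right : ContinuousOn (fun t => T 0 t) (Ici 0)

/-- The cocycle identity follows from uniqueness for the linear equation: both sides solve it in `t`
and agree at `t = r`. Continuity in the second time comes from `T(0,t) = T(t,0)⁻¹`. -/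
theorem IsEvolutionOperator.isEvolutionFamily [CompleteSpace X] {A : ℝ → X →L[ℝ] X}
    {T : ℝ → ℝ → X →L[ℝ] X} (hA : ContinuousOn A (Ici 0)) (hT : IsEvolutionOperator A T) :
    IsEvolutionFamily T := by
  have hcont : ∀ s, 0 ≤ s → ContinuousOn (fun t => T t s) (Ici 0) := fun s hs t ht =>
    (hT.hasDeriv s hs t ht).continuousWithinAt
  have hcomp : ∀ t r s, 0 ≤ t → 0 ≤ r → 0 ≤ s → (T t r).comp (T r s) = T t s := by
    intro t r s ht hr hs
    set b := max t r + 1 with hb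
    have htb : t ≤ b := (le_max_left t r).trans (by linarith)
    have hrb : r ≤ b := (le_max_right t r).trans (by linarith)
    obtain ⟨M, hM⟩ := isCompact_Icc.exists_bound_of_continuousOn
      (hA.mono (Icc_subset_Ici_self : Icc 0 b ⊆ Ici 0))
    have hM0 : 0 ≤ M := (norm_nonneg _).trans (hM 0 ⟨le_rfl, ht.trans htb⟩)
    let v : ℝ → (X →L[ℝ] X) → (X →L[ℝ] X) := fun t Z => (A t).comp Z
    have hv : ∀ t ∈ Icc 0 b, LipschitzOnWith M.toNNReal (v t) univ := by
      intro t ht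
      refine LipschitzOnWith.of_dist_le_mul fun Z _ W _ => ?_
      rw [dist_eq_norm, dist_eq_norm, Real.coe_toNNReal _ hM0]
      have : v t Z - v t W = (A t).comp (Z - W) := by simp [v, ContinuousLinearMap.comp_sub]
      rw [this]
      exact (ContinuousLinearMap.opNorm_comp_le _ _).trans
        (mul_le_mul_of_nonneg_right (hM t ht) (norm_nonneg _))
    have hf : ∀ t, 0 ≤ t →
        HasDerivWithinAt (fun t => (T t r).comp (T r s)) (v t ((T t r).comp (T r s))) (Ici 0) t := by
      intro t ht
      refine ((hT.hasDeriv r hr t ht).clm_comp (hasDerivWithinAt_const t (Ici 0) (T r s))).congr_deriv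
        ?_
      simp [v, ContinuousLinearMap.comp_assoc]
    have hg : ∀ t, 0 ≤ t → HasDerivWithinAt (fun t => T t s) (v t (T t s)) (Ici 0) t :=
      fun t ht => hT.hasDeriv s hs t ht
    have heq : (T r r).comp (T r s) = T r s := by rw [hT.self r hr]; rfl
    rcases le_total r t with hrt | htr
    · exact ODE_solution_unique_of_mem_Icc_right (a := r) (b := t) (v := v) (s := fun _ => univ)
        (fun τ hτ => hv τ ⟨hr.trans hτ.1, hτ.2.le.trans htb⟩)
        (fun τ hτ => ((hf τ (hr.trans hτ.1)).continuousWithinAt).mono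
          fun x hx => hr.trans hx.1)
        (fun τ hτ => (hf τ (hr.trans hτ.1)).mono fun x hx => (hr.trans hτ.1).trans hx)
        (fun _ _ => trivial)
        (fun τ hτ => ((hg τ (hr.trans hτ.1)).continuousWithinAt).mono
          fun x hx => hr.trans hx.1)
        (fun τ hτ => (hg τ (hr.trans hτ.1)).mono fun x hx => (hr.trans hτ.1).trans hx)
        (fun _ _ => trivial) heq ⟨hrt, le_rfl⟩
    · exact ODE_solution_unique_of_mem_Icc_left (a := t) (b := r) (v := v) (s := fun _ => univ)
        (fun τ hτ => hv τ ⟨ht.trans hτ.1.le, hτ.2.trans hrb⟩)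
        (fun τ hτ => ((hf τ (ht.trans hτ.1)).continuousWithinAt).mono
          fun x hx => ht.trans hx.1)
        (fun τ hτ => ((hf τ (ht.trans hτ.1.le)).hasDerivAt
          (Ici_mem_nhds (ht.trans_lt hτ.1))).hasDerivWithinAt)
        (fun _ _ => trivial)
        (fun τ hτ => ((hg τ (ht.trans hτ.1)).continuousWithinAt).mono
          fun x hx => ht.trans hx.1)
        (fun τ hτ => ((hg τ (ht.trans hτ.1.le)).hasDerivAt
          (Ici_mem_nhds (ht.trans_lt hτ.1))).hasDerivWithinAt)
        (fun _ _ => trivial) heq ⟨le_rfl, htr⟩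
  refine ⟨hT.self, hcomp, hcont 0 le_rfl, ?_⟩
  have hinv : ∀ t, 0 ≤ t → ∃ u : (X →L[ℝ] X)ˣ, (u : X →L[ℝ] X) = T t 0 ∧
      ((u⁻¹ : (X →L[ℝ] X)ˣ) : X →L[ℝ] X) = T 0 t := fun t ht =>
    ⟨⟨T t 0, T 0 t, (hcomp t 0 t ht le_rfl ht).trans (hT.self t ht),
      (hcomp 0 t 0 le_rfl ht le_rfl).trans (hT.self 0 le_rfl)⟩, rfl, rfl⟩
  have heq : ∀ t ∈ Ici (0 : ℝ), T 0 t = Ring.inverse (T t 0) := by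
    intro t ht
    obtain ⟨u, hu, hu'⟩ := hinv t ht
    rw [← hu, Ring.inverse_unit, hu']
  refine ContinuousOn.congr (fun t ht => ?_) heq
  obtain ⟨u, hu, -⟩ := hinv t ht
  have := NormedRing.inverse_continuousAt u
  rw [hu] at this
  exact this.comp_continuousWithinAt (f := fun t => T t 0) (hcont 0 le_rfl t ht)

section EvolutionFamily

variable {T : ℝ → ℝ → X →L[ℝ] X}

theorem IsEvolutionFamily.comp_apply (hT : IsEvolutionFamily T) {t r s : ℝ} (ht : 0 ≤ t)
    (hr : 0 ≤ r) (hs : 0 ≤ s) (x : X) : T t r (T r s x) = T t s x := by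
  rw [← hT.comp t r s ht hr hs]; rfl

theorem IsEvolutionFamily.self_apply (hT : IsEvolutionFamily T) {t : ℝ} (ht : 0 ≤ t) (x : X) :
    T t t x = x := by
  rw [hT.self t ht]; rfl

theorem IsEvolutionFamily.continuousOn_fst (hT : IsEvolutionFamily T) {s : ℝ} (hs : 0 ≤ s) :
    ContinuousOn (fun t => T t s) (Ici 0) :=
  (hT.continuousOn_left.clm_comp continuousOn_const).congr fun t ht =>
    (hT.comp t 0 s ht le_rfl hs).symm

theorem IsEvolutionFamily.continuousOn_snd (hT : IsEvolutionFamily T) {t : ℝ} (ht : 0 ≤ t) :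
    ContinuousOn (fun s => T t s) (Ici 0) :=
  ((continuousOn_const (c := T t 0)).clm_comp hT.continuousOn_right).congr fun s hs =>
    (hT.comp t 0 s ht le_rfl hs).symm

/-- The norm of the evolution family is bounded on bounded time intervals. -/
theorem IsEvolutionFamily.exists_bound (hT : IsEvolutionFamily T) (S : ℝ) :
    ∃ M, 0 ≤ M ∧ ∀ t ∈ Icc 0 S, ∀ s ∈ Icc 0 S, ‖T t s‖ ≤ M := by
  obtain ⟨M₁, hM₁⟩ := isCompact_Icc.exists_bound_of_continuousOn
    (hT.continuousOn_left.mono (Icc_subset_Ici_self : Icc 0 S ⊆ Ici 0))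
  obtain ⟨M₂, hM₂⟩ := isCompact_Icc.exists_bound_of_continuousOn
    (hT.continuousOn_right.mono (Icc_subset_Ici_self : Icc 0 S ⊆ Ici 0))
  refine ⟨|M₁| * |M₂|, by positivity, fun t ht s hs => ?_⟩
  rw [← hT.comp t 0 s ht.1 le_rfl hs.1]
  exact (ContinuousLinearMap.opNorm_comp_le _ _).trans <| mul_le_mul
    ((hM₁ t ht).trans (le_abs_self _)) ((hM₂ s hs).trans (le_abs_self _)) (norm_nonneg _)
    (abs_nonneg _)

/-! ### Mild solutions -/

/-- `x` is a mild solution on `[s, ∞)` of the inhomogeneous linear equation `x' = A(t) x + G(t)`.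
The variation-of-constants formula is imposed between all pairs of times, so that restricting to a
later initial time is immediate. -/
structure IsMild (T : ℝ → ℝ → X →L[ℝ] X) (s : ℝ) (x G : ℝ → X) : Prop where
  nonneg : 0 ≤ s
  continuousOn : ContinuousOn x (Ici s)
  continuousOn_forcing : ContinuousOn G (Ici s)
  eq : ∀ r t, s ≤ r → r ≤ t → x t = T t r (x r) + ∫ τ in r..t, T t τ (G τ)

theorem IsMild.mono {s r : ℝ} {x G : ℝ → X} (hx : IsMild T s x G) (hr : s ≤ r) :
    IsMild T r x G :=
  ⟨hx.nonneg.trans hr, hx.continuousOn.mono (Ici_subset_Ici.2 hr),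
    hx.continuousOn_forcing.mono (Ici_subset_Ici.2 hr), fun r' t h1 h2 => hx.eq r' t (hr.trans h1) h2⟩

theorem IsEvolutionFamily.continuousOn_apply (hT : IsEvolutionFamily T) {t s : ℝ} (ht : 0 ≤ t)
    (hs : 0 ≤ s) {G : ℝ → X} (hG : ContinuousOn G (Ici s)) :
    ContinuousOn (fun τ => T t τ (G τ)) (Ici s) :=
  ((hT.continuousOn_snd ht).mono (Ici_subset_Ici.2 hs)).clm_apply hG

theorem intervalIntegrable_of_continuousOn_Ici {E : Type*} [NormedAddCommGroup E] {s r t : ℝ}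
    {G : ℝ → E} (hG : ContinuousOn G (Ici s)) (hr : s ≤ r) (ht : s ≤ t) :
    IntervalIntegrable G volume r t :=
  (hG.mono fun _ hx => (le_min hr ht).trans hx.1).intervalIntegrable

theorem IsMild.sub (hT : IsEvolutionFamily T) {s : ℝ} {x y G H : ℝ → X} (hx : IsMild T s x G)
    (hy : IsMild T s y H) : IsMild T s (fun t => x t - y t) (fun t => G t - H t) := by
  refine ⟨hx.nonneg, hx.continuousOn.sub hy.continuousOn,
    hx.continuousOn_forcing.sub hy.continuousOn_forcing, fun r t hr hrt => ?_⟩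
  have ht0 := hx.nonneg.trans (hr.trans hrt)
  simp only [map_sub]
  rw [intervalIntegral.integral_sub
    (intervalIntegrable_of_continuousOn_Ici
      (hT.continuousOn_apply ht0 hx.nonneg hx.continuousOn_forcing) hr (hr.trans hrt))
    (intervalIntegrable_of_continuousOn_Ici
      (hT.continuousOn_apply ht0 hx.nonneg hy.continuousOn_forcing) hr (hr.trans hrt)),
    hx.eq r t hr hrt, hy.eq r t hr hrt]
  abel

theorem IsMild.congr {s : ℝ} {x y G H : ℝ → X} (hx : IsMild T s x G)
    (hxy : ∀ t, s ≤ t → y t = x t) (hGH : ∀ t, s ≤ t → H t = G t) : IsMild T s y H := by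
  refine ⟨hx.nonneg, hx.continuousOn.congr hxy, hx.continuousOn_forcing.congr hGH,
    fun r t hr hrt => ?_⟩
  rw [hxy t (hr.trans hrt), hxy r hr, hx.eq r t hr hrt]
  congr 1
  refine intervalIntegral.integral_congr fun τ hτ => ?_
  rw [uIcc_of_le hrt] at hτ
  simp only [hGH τ (hr.trans hτ.1)]

/-- A bounded operator may be moved inside the variation-of-constants integral. -/
theorem IsEvolutionFamily.map_integral [CompleteSpace X] (hT : IsEvolutionFamily T) {s r t t' : ℝ}
    (hs : 0 ≤ s) (hr : s ≤ r) (ht : s ≤ t) (ht' : 0 ≤ t') (L : X →L[ℝ] X) {G : ℝ → X}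
    (hG : ContinuousOn G (Ici s)) :
    L (∫ τ in r..t, T t' τ (G τ)) = ∫ τ in r..t, L (T t' τ (G τ)) :=
  (L.intervalIntegral_comp_comm (intervalIntegrable_of_continuousOn_Ici
    (hT.continuousOn_apply ht' hs hG) hr ht)).symm

/-- The variation-of-constants formula from the initial time alone defines a mild solution. -/
theorem IsEvolutionFamily.isMild_of_initial [CompleteSpace X] (hT : IsEvolutionFamily T) {s : ℝ}
    (hs : 0 ≤ s) (x₀ : X) {G : ℝ → X} (hG : ContinuousOn G (Ici s)) :
    IsMild T s (fun t => T t s (x₀ + ∫ τ in s..t, T s τ (G τ))) G := by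
  have hint : ∀ {r t}, s ≤ r → s ≤ t → IntervalIntegrable (fun τ => T s τ (G τ)) volume r t :=
    fun hr ht => intervalIntegrable_of_continuousOn_Ici (hT.continuousOn_apply hs hs hG) hr ht
  refine ⟨hs, ?_, hG, fun r t hr hrt => ?_⟩
  · refine ((hT.continuousOn_fst hs).mono (Ici_subset_Ici.2 hs)).clm_apply
      (continuousOn_const.add ?_)
    intro t ht
    have h1 := intervalIntegral.continuousOn_primitive_interval'
      (hint (le_refl s) (show s ≤ t + 1 by have := mem_Ici.1 ht; linarith)) left_mem_uIcc
    have ht' := mem_Ici.1 ht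
    rw [uIcc_of_le (by linarith)] at h1
    refine (h1 t ⟨ht, by linarith⟩).mono_of_mem_nhdsWithin ?_
    rw [← Ici_inter_Iic]
    exact inter_mem self_mem_nhdsWithin (mem_nhdsWithin_of_mem_nhds (Iic_mem_nhds (by linarith)))
  · have hr0 := hs.trans hr
    have ht0 := hr0.trans hrt
    simp only [hT.comp_apply ht0 hr0 hs]
    rw [← intervalIntegral.integral_add_adjacent_intervals (hint le_rfl hr)
      (hint hr (hr.trans hrt)), ← add_assoc, map_add]
    congr 1
    rw [hT.map_integral hs hr (hr.trans hrt) hs _ hG]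
    refine intervalIntegral.integral_congr fun τ hτ => ?_
    rw [uIcc_of_le hrt] at hτ
    exact hT.comp_apply ht0 hs (hr0.trans hτ.1) _

end EvolutionFamily

/-! ### Estimates for the dichotomy -/

/-- A nonuniform dichotomy of an evolution family whose growth rates satisfy the hypotheses of the
stable manifold theorem: `C(0) < ∞`, `k^{-b} h^a ν^ε → 0`, and `h^a β^ε` nonincreasing. -/
structure IsAdmissible (T : ℝ → ℝ → X →L[ℝ] X) (P : ℝ → X →L[ℝ] X) (h k μ ν : ℝ → ℝ)
    (a b ε K q : ℝ) : Prop where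
  evol : IsEvolutionFamily T
  rate_h : IsGrowthRate h
  rate_k : IsGrowthRate k
  rate_μ : IsGrowthRate μ
  rate_ν : IsGrowthRate ν
  q_pos : 0 < q
  dich : IsDichotomy T P h k μ ν a b ε K
  integrable : IntegrableOn (tailIntegrand h μ ν a ε q) (Ioi 0)
  tendsto : Tendsto (fun t => k t ^ (-b) * h t ^ a * ν t ^ ε) atTop (𝓝 0)
  antitone : AntitoneOn (fun t => h t ^ a * betaPow h k μ ν a b ε q t) (Ici 0)

theorem IsGrowthRate.one_le {u : ℝ → ℝ} (hu : IsGrowthRate u) {t : ℝ} (ht : 0 ≤ t) : 1 ≤ u t :=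
  hu.map_zero ▸ hu.monotoneOn self_mem_Ici ht ht

/-- Membership in the stable space is invariance under the projection. -/
theorem IsDichotomy.mem_stableSpace_iff {T : ℝ → ℝ → X →L[ℝ] X} {P : ℝ → X →L[ℝ] X}
    {h k μ ν : ℝ → ℝ} {a b ε K : ℝ} (hD : IsDichotomy T P h k μ ν a b ε K) {t : ℝ} (ht : 0 ≤ t)
    {x : X} : x ∈ stableSpace P t ↔ P t x = x := by
  refine ⟨?_, fun hx => ⟨x, hx⟩⟩
  rintro ⟨y, rfl⟩
  exact DFunLike.congr_fun (hD.proj t ht) y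

theorem IsDichotomy.mem_unstableSpace_iff {T : ℝ → ℝ → X →L[ℝ] X} {P : ℝ → X →L[ℝ] X}
    {h k μ ν : ℝ → ℝ} {a b ε K : ℝ} (hD : IsDichotomy T P h k μ ν a b ε K) {t : ℝ} (ht : 0 ≤ t)
    {x : X} : x ∈ unstableSpace P t ↔ P t x = 0 := by
  refine ⟨?_, fun hx => ⟨x, by simp [compl, hx]⟩⟩
  rintro ⟨y, rfl⟩
  have := DFunLike.congr_fun (hD.proj t ht) y
  simp only [ContinuousLinearMap.comp_apply] at this
  simp [compl, this]

theorem compl_apply (P : ℝ → X →L[ℝ] X) (t : ℝ) (x : X) : compl P t x = x - P t x := rfl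

theorem add_compl_apply (P : ℝ → X →L[ℝ] X) (t : ℝ) (x : X) : P t x + compl P t x = x := by
  simp [compl]

namespace IsAdmissible

variable {T : ℝ → ℝ → X →L[ℝ] X} {P : ℝ → X →L[ℝ] X} {h k μ ν : ℝ → ℝ} {a b ε K q : ℝ}

theorem proj_evol (S : IsAdmissible T P h k μ ν a b ε K q) {t s : ℝ} (ht : 0 ≤ t) (hs : 0 ≤ s)
    (x : X) : P t (T t s x) = T t s (P s x) :=
  DFunLike.congr_fun (S.dich.comm t s ht hs) x

theorem compl_evol (S : IsAdmissible T P h k μ ν a b ε K q) {t s : ℝ} (ht : 0 ≤ t) (hs : 0 ≤ s)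
    (x : X) : compl P t (T t s x) = T t s (compl P s x) := by
  simp [compl, S.proj_evol ht hs]

theorem continuousOn_proj (S : IsAdmissible T P h k μ ν a b ε K q) : ContinuousOn P (Ici 0) := by
  refine ((S.evol.continuousOn_left.clm_comp (continuousOn_const (c := P 0))).clm_comp
    S.evol.continuousOn_right).congr fun t ht => ?_
  change P t = ((T t 0).comp (P 0)).comp (T 0 t)
  rw [← S.dich.comm t 0 ht le_rfl, ContinuousLinearMap.comp_assoc,
    S.evol.comp t 0 t ht le_rfl ht, S.evol.self t ht]
  rfl

theorem continuousOn_compl (S : IsAdmissible T P h k μ ν a b ε K q) :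
    ContinuousOn (compl P) (Ici 0) :=
  continuousOn_const.sub S.continuousOn_proj

theorem K_pos (S : IsAdmissible T P h k μ ν a b ε K q) : 0 < K := S.dich.K_pos

theorem weight_pos (S : IsAdmissible T P h k μ ν a b ε K q) {t : ℝ} (ht : 0 ≤ t) : 0 < h t ^ a :=
  Real.rpow_pos_of_pos (S.rate_h.pos t ht) _

theorem weight_antitone (S : IsAdmissible T P h k μ ν a b ε K q) {s t : ℝ} (hs : 0 ≤ s)
    (hst : s ≤ t) : h t ^ a ≤ h s ^ a :=
  Real.rpow_le_rpow_of_nonpos (S.rate_h.pos s hs) (S.rate_h.monotoneOn hs (hs.trans hst) hst)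
    S.dich.a_neg.le

theorem weight_le_one (S : IsAdmissible T P h k μ ν a b ε K q) {t : ℝ} (ht : 0 ≤ t) :
    h t ^ a ≤ 1 :=
  Real.rpow_le_one_of_one_le_of_nonpos (S.rate_h.one_le ht) S.dich.a_neg.le

theorem one_le_μ_rpow (S : IsAdmissible T P h k μ ν a b ε K q) {t : ℝ} (ht : 0 ≤ t) :
    1 ≤ μ t ^ ε :=
  Real.one_le_rpow (S.rate_μ.one_le ht) S.dich.ε_nonneg

theorem ν_rpow_pos (S : IsAdmissible T P h k μ ν a b ε K q) {t : ℝ} (ht : 0 ≤ t) : 0 < ν t ^ ε :=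
  Real.rpow_pos_of_pos (S.rate_ν.pos t ht) _

theorem norm_stable_le (S : IsAdmissible T P h k μ ν a b ε K q) {t s : ℝ} (hs : 0 ≤ s)
    (hst : s ≤ t) (x : X) :
    ‖T t s (P s x)‖ ≤ K * (h t ^ a / h s ^ a) * μ s ^ ε * ‖x‖ := by
  have h1 := S.dich.stable t s hs hst
  rw [abs_of_nonneg hs, Real.div_rpow (S.rate_h.pos t (hs.trans hst)).le (S.rate_h.pos s hs).le]
    at h1
  exact ((T t s).comp (P s)).le_of_opNorm_le h1 x

/-- The unstable bound with the two values of `k` separated. -/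
theorem norm_unstable_le_mul (S : IsAdmissible T P h k μ ν a b ε K q) {t s : ℝ} (ht : 0 ≤ t)
    (hts : t ≤ s) (x : X) :
    ‖T t s (compl P s x)‖ ≤ K * k t ^ b * (k s ^ (-b) * ν s ^ ε) * ‖x‖ := by
  have h1 := S.dich.unstable t s ht hts
  rw [abs_of_nonneg (ht.trans hts),
    Real.div_rpow (S.rate_k.pos s (ht.trans hts)).le (S.rate_k.pos t ht).le,
    Real.rpow_neg (S.rate_k.pos t ht).le, div_inv_eq_mul] at h1
  refine (((T t s).comp (compl P s)).le_of_opNorm_le h1 x).trans_eq ?_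
  ring

theorem norm_unstable_le (S : IsAdmissible T P h k μ ν a b ε K q) {t s : ℝ} (ht : 0 ≤ t)
    (hts : t ≤ s) (x : X) : ‖T t s (compl P s x)‖ ≤ K * ν s ^ ε * ‖x‖ := by
  have h1 := S.dich.unstable t s ht hts
  rw [abs_of_nonneg (ht.trans hts)] at h1
  refine ((T t s).comp (compl P s)).le_of_opNorm_le (h1.trans ?_) x
  have h2 : (k s / k t) ^ (-b) ≤ 1 := by
    refine Real.rpow_le_one_of_one_le_of_nonpos ?_ (by have := S.dich.b_nonneg; linarith)
    rw [one_le_div (S.rate_k.pos t ht)]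
    exact S.rate_k.monotoneOn ht (ht.trans hts) hts
  have h3 := S.K_pos.le
  have h4 := (S.ν_rpow_pos (ht.trans hts)).le
  calc K * (k s / k t) ^ (-b) * ν s ^ ε ≤ K * 1 * ν s ^ ε := by gcongr
    _ = K * ν s ^ ε := by ring

/-! ### The tail integral -/

theorem μ_mul_le_tailIntegrand (S : IsAdmissible T P h k μ ν a b ε K q) {t : ℝ} (ht : 0 ≤ t) :
    μ t ^ ε * (h t ^ a) ^ q ≤ tailIntegrand h μ ν a ε q t := by
  rw [tailIntegrand, Real.rpow_mul (S.rate_h.pos t ht).le, mul_comm]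
  exact mul_le_mul_of_nonneg_left (le_max_left _ _) (Real.rpow_nonneg (S.weight_pos ht).le _)

theorem ν_mul_le_tailIntegrand (S : IsAdmissible T P h k μ ν a b ε K q) {t : ℝ} (ht : 0 ≤ t) :
    ν t ^ ε * (h t ^ a) ^ q ≤ tailIntegrand h μ ν a ε q t := by
  rw [tailIntegrand, Real.rpow_mul (S.rate_h.pos t ht).le, mul_comm]
  exact mul_le_mul_of_nonneg_left (le_max_right _ _) (Real.rpow_nonneg (S.weight_pos ht).le _)

theorem tailIntegrand_pos (S : IsAdmissible T P h k μ ν a b ε K q) {t : ℝ} (ht : 0 ≤ t) :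
    0 < tailIntegrand h μ ν a ε q t :=
  (mul_pos (zero_lt_one.trans_le (S.one_le_μ_rpow ht))
    (Real.rpow_pos_of_pos (S.weight_pos ht) _)).trans_le (S.μ_mul_le_tailIntegrand ht)

theorem integrableOn_tail (S : IsAdmissible T P h k μ ν a b ε K q) {s : ℝ} (hs : 0 ≤ s) :
    IntegrableOn (tailIntegrand h μ ν a ε q) (Ioi s) :=
  S.integrable.mono_set (Ioi_subset_Ioi hs)

theorem intervalIntegrable_tail (S : IsAdmissible T P h k μ ν a b ε K q) {s t : ℝ} (hs : 0 ≤ s)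
    (hst : s ≤ t) : IntervalIntegrable (tailIntegrand h μ ν a ε q) volume s t :=
  (intervalIntegrable_iff_integrableOn_Ioc_of_le hst).2
    ((S.integrableOn_tail hs).mono_set Ioc_subset_Ioi_self)

theorem setIntegral_tail_mono (S : IsAdmissible T P h k μ ν a b ε K q) {s : ℝ} (hs : 0 ≤ s)
    {A : Set ℝ} (hA : A ⊆ Ioi s) :
    ∫ τ in A, tailIntegrand h μ ν a ε q τ ≤ tailC h μ ν a ε q s :=
  setIntegral_mono_set (S.integrableOn_tail hs)
    ((ae_restrict_iff' measurableSet_Ioi).2 (Eventually.of_forall fun _ hτ =>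
      (S.tailIntegrand_pos (hs.trans (le_of_lt hτ))).le)) hA.eventuallyLE

theorem integral_tail_le (S : IsAdmissible T P h k μ ν a b ε K q) {s t : ℝ} (hs : 0 ≤ s)
    (hst : s ≤ t) : ∫ τ in s..t, tailIntegrand h μ ν a ε q τ ≤ tailC h μ ν a ε q s := by
  rw [intervalIntegral.integral_of_le hst]
  exact S.setIntegral_tail_mono hs Ioc_subset_Ioi_self

theorem tailC_antitone (S : IsAdmissible T P h k μ ν a b ε K q) {s t : ℝ} (hs : 0 ≤ s)
    (hst : s ≤ t) : tailC h μ ν a ε q t ≤ tailC h μ ν a ε q s :=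
  S.setIntegral_tail_mono hs (Ioi_subset_Ioi hst)

theorem tailC_pos (S : IsAdmissible T P h k μ ν a b ε K q) {s : ℝ} (hs : 0 ≤ s) :
    0 < tailC h μ ν a ε q s := by
  refine (setIntegral_pos_iff_support_of_nonneg_ae
    ((ae_restrict_iff' measurableSet_Ioi).2 (Eventually.of_forall fun _ hτ =>
      (S.tailIntegrand_pos (hs.trans (le_of_lt hτ))).le)) (S.integrableOn_tail hs)).2 ?_
  have : Function.support (tailIntegrand h μ ν a ε q) ∩ Ioi s = Ioi s :=
    inter_eq_right.2 fun _ hτ => (S.tailIntegrand_pos (hs.trans (le_of_lt hτ))).ne'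
  rw [this, Real.volume_Ioi]
  exact ENNReal.zero_lt_top

/-- An integrand dominated on `[s, t]` by a multiple of the tail integrand. -/
theorem norm_integral_le_of_tail (S : IsAdmissible T P h k μ ν a b ε K q) {s r t B : ℝ}
    (hs : 0 ≤ s) (hr : s ≤ r) (hrt : r ≤ t) (hB : 0 ≤ B) {F : ℝ → X}
    (hF : ∀ τ, r ≤ τ → τ ≤ t → ‖F τ‖ ≤ B * tailIntegrand h μ ν a ε q τ) :
    ‖∫ τ in r..t, F τ‖ ≤ B * tailC h μ ν a ε q s := by
  refine (intervalIntegral.norm_integral_le_of_norm_le hrt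
    (Eventually.of_forall fun τ hτ => hF τ hτ.1.le hτ.2)
    ((S.intervalIntegrable_tail (hs.trans hr) hrt).const_mul B)).trans ?_
  rw [intervalIntegral.integral_const_mul]
  exact mul_le_mul_of_nonneg_left ((S.integral_tail_le (hs.trans hr) hrt).trans
    (S.tailC_antitone hs hr)) hB

/-! ### Bounds for decaying mild solutions -/

theorem proj_mild [CompleteSpace X] (S : IsAdmissible T P h k μ ν a b ε K q) {s : ℝ}
    {x G : ℝ → X} (hx : IsMild T s x G) {r t : ℝ} (hr : s ≤ r) (hrt : r ≤ t) :
    P t (x t) = T t r (P r (x r)) + ∫ τ in r..t, T t τ (P τ (G τ)) := by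
  have ht0 := hx.nonneg.trans (hr.trans hrt)
  rw [hx.eq r t hr hrt, map_add, S.proj_evol ht0 (hx.nonneg.trans hr),
    S.evol.map_integral hx.nonneg hr (hr.trans hrt) ht0 _ hx.continuousOn_forcing]
  congr 1
  refine intervalIntegral.integral_congr fun τ hτ => ?_
  rw [uIcc_of_le hrt] at hτ
  exact S.proj_evol ht0 (hx.nonneg.trans (hr.trans hτ.1)) _

theorem compl_mild [CompleteSpace X] (S : IsAdmissible T P h k μ ν a b ε K q) {s : ℝ}
    {x G : ℝ → X} (hx : IsMild T s x G) {r t : ℝ} (hr : s ≤ r) (hrt : r ≤ t) :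
    compl P t (x t) = T t r (compl P r (x r)) + ∫ τ in r..t, T t τ (compl P τ (G τ)) := by
  have ht0 := hx.nonneg.trans (hr.trans hrt)
  rw [hx.eq r t hr hrt, map_add, S.compl_evol ht0 (hx.nonneg.trans hr),
    S.evol.map_integral hx.nonneg hr (hr.trans hrt) ht0 _ hx.continuousOn_forcing]
  congr 1
  refine intervalIntegral.integral_congr fun τ hτ => ?_
  rw [uIcc_of_le hrt] at hτ
  exact S.compl_evol ht0 (hx.nonneg.trans (hr.trans hτ.1)) _

/-- The unstable component pulled back from `t` to an earlier time `r`. -/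
theorem evol_compl_mild [CompleteSpace X] (S : IsAdmissible T P h k μ ν a b ε K q) {s : ℝ}
    {x G : ℝ → X} (hx : IsMild T s x G) {r t : ℝ} (hr : s ≤ r) (hrt : r ≤ t) :
    T r t (compl P t (x t)) = compl P r (x r) + ∫ τ in r..t, T r τ (compl P τ (G τ)) := by
  have hr0 := hx.nonneg.trans hr
  have ht0 := hr0.trans hrt
  rw [S.compl_mild hx hr hrt, map_add, S.evol.comp_apply hr0 ht0 hr0, S.evol.self_apply hr0,
    S.evol.map_integral hx.nonneg hr (hr.trans hrt) ht0 _
      (((S.continuousOn_compl).mono (Ici_subset_Ici.2 hx.nonneg)).clm_apply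
        hx.continuousOn_forcing)]
  congr 1
  refine intervalIntegral.integral_congr fun τ hτ => ?_
  rw [uIcc_of_le hrt] at hτ
  exact S.evol.comp_apply hr0 ht0 (hr0.trans hτ.1) _

/-- The stable component of a mild solution. The weight `w` is used both for `w = h^a` and for
`w = 1`; the hypothesis `hw` says that it decays no faster than `h^a`. -/
theorem norm_proj_le [CompleteSpace X] (S : IsAdmissible T P h k μ ν a b ε K q) {s B : ℝ}
    {x G : ℝ → X} {w : ℝ → ℝ} (hx : IsMild T s x G) (hB : 0 ≤ B) (hw0 : ∀ t, s ≤ t → 0 ≤ w t)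
    (hw : ∀ r t, s ≤ r → r ≤ t → h t ^ a / h r ^ a * w r ≤ w t)
    (hG : ∀ t, s ≤ t → ‖G t‖ ≤ B * w t * (h t ^ a) ^ q) {t : ℝ} (ht : s ≤ t) :
    ‖P t (x t)‖ ≤ K * (h t ^ a / h s ^ a) * μ s ^ ε * ‖P s (x s)‖
      + K * B * tailC h μ ν a ε q s * w t := by
  have hs := hx.nonneg
  rw [S.proj_mild hx le_rfl ht]
  refine (norm_add_le _ _).trans (add_le_add ?_ ?_)
  · have := S.norm_stable_le hs ht (P s (x s))
    rwa [show P s (P s (x s)) = P s (x s) from DFunLike.congr_fun (S.dich.proj s hs) _] at this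
  · have hK := S.K_pos.le
    rw [mul_right_comm]
    refine S.norm_integral_le_of_tail hs le_rfl ht
      (mul_nonneg (mul_nonneg hK hB) (hw0 t ht)) fun τ hτ hτt => ?_
    have hτ0 := hs.trans hτ
    have h1 := S.one_le_μ_rpow hτ0
    have h2 : 0 ≤ h t ^ a / h τ ^ a :=
      div_nonneg (S.weight_pos (hτ0.trans hτt)).le (S.weight_pos hτ0).le
    have h3 : 0 ≤ (h τ ^ a) ^ q := Real.rpow_nonneg (S.weight_pos hτ0).le _
    calc ‖T t τ (P τ (G τ))‖ ≤ K * (h t ^ a / h τ ^ a) * μ τ ^ ε * ‖G τ‖ :=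
          S.norm_stable_le hτ0 hτt _
      _ ≤ K * (h t ^ a / h τ ^ a) * μ τ ^ ε * (B * w τ * (h τ ^ a) ^ q) := by
          gcongr; exact hG τ hτ
      _ = K * B * (h t ^ a / h τ ^ a * w τ) * (μ τ ^ ε * (h τ ^ a) ^ q) := by ring
      _ ≤ K * B * w t * tailIntegrand h μ ν a ε q τ :=
          mul_le_mul (mul_le_mul_of_nonneg_left (hw τ t hτ hτt) (mul_nonneg hK hB))
            (S.μ_mul_le_tailIntegrand hτ0) (mul_nonneg (by linarith) h3)
            (mul_nonneg (mul_nonneg hK hB) (hw0 t ht))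

/-- The unstable component of a decaying mild solution is controlled by the forcing alone: pulled
back from time `r`, it tends to `0` as `r → ∞` because `k^{-b} h^a ν^ε → 0`. -/
theorem norm_compl_le [CompleteSpace X] (S : IsAdmissible T P h k μ ν a b ε K q) {s B N : ℝ}
    {x G : ℝ → X} {w : ℝ → ℝ} (hx : IsMild T s x G) (hN : ∀ t, s ≤ t → ‖x t‖ ≤ N * h t ^ a)
    (hB : 0 ≤ B) (hw0 : ∀ t, s ≤ t → 0 ≤ w t) (hw : ∀ r t, s ≤ r → r ≤ t → w t ≤ w r)
    (hG : ∀ t, s ≤ t → ‖G t‖ ≤ B * w t * (h t ^ a) ^ q) {t : ℝ} (ht : s ≤ t) :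
    ‖compl P t (x t)‖ ≤ K * B * tailC h μ ν a ε q s * w t := by
  have hs := hx.nonneg
  have ht0 := hs.trans ht
  have hK := S.K_pos.le
  have hlim : Tendsto (fun r => K * k t ^ b * (k r ^ (-b) * h r ^ a * ν r ^ ε) * N
      + K * B * tailC h μ ν a ε q s * w t) atTop (𝓝 (K * B * tailC h μ ν a ε q s * w t)) := by
    have := ((S.tendsto.const_mul (K * k t ^ b)).mul_const N).add_const
      (K * B * tailC h μ ν a ε q s * w t)
    simpa using this
  refine ge_of_tendsto hlim ((eventually_ge_atTop t).mono fun r hr => ?_)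
  have hr0 := ht0.trans hr
  have heq : compl P t (x t) = T t r (compl P r (x r)) - ∫ τ in t..r, T t τ (compl P τ (G τ)) := by
    rw [S.evol_compl_mild hx ht hr]; abel
  rw [heq]
  refine (norm_sub_le _ _).trans (add_le_add ?_ ?_)
  · have h1 : 0 ≤ k t ^ b := Real.rpow_nonneg (S.rate_k.pos t ht0).le _
    have h2 : 0 ≤ k r ^ (-b) := Real.rpow_nonneg (S.rate_k.pos r hr0).le _
    have h3 := (S.ν_rpow_pos hr0).le
    calc ‖T t r (compl P r (x r))‖ ≤ K * k t ^ b * (k r ^ (-b) * ν r ^ ε) * ‖x r‖ :=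
          S.norm_unstable_le_mul ht0 hr _
      _ ≤ K * k t ^ b * (k r ^ (-b) * ν r ^ ε) * (N * h r ^ a) := by
          gcongr; exact hN r (ht.trans hr)
      _ = _ := by ring
  · rw [mul_right_comm]
    refine S.norm_integral_le_of_tail hs ht hr
      (mul_nonneg (mul_nonneg hK hB) (hw0 t ht)) fun τ hτ hτr => ?_
    have hτ0 := ht0.trans hτ
    have h1 := (S.ν_rpow_pos hτ0).le
    have h3 : 0 ≤ (h τ ^ a) ^ q := Real.rpow_nonneg (S.weight_pos hτ0).le _
    calc ‖T t τ (compl P τ (G τ))‖ ≤ K * ν τ ^ ε * ‖G τ‖ := S.norm_unstable_le ht0 hτ _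
      _ ≤ K * ν τ ^ ε * (B * w τ * (h τ ^ a) ^ q) := by
          gcongr; exact hG τ (ht.trans hτ)
      _ = K * B * w τ * (ν τ ^ ε * (h τ ^ a) ^ q) := by ring
      _ ≤ K * B * w t * tailIntegrand h μ ν a ε q τ :=
          mul_le_mul (mul_le_mul_of_nonneg_left (hw t τ ht hτ) (mul_nonneg hK hB))
            (S.ν_mul_le_tailIntegrand hτ0) (mul_nonneg h1 h3)
            (mul_nonneg (mul_nonneg hK hB) (hw0 t ht))

/-- A forcing of size `h^{a(q+1)}` admits a mild solution of size `h^a` with prescribed stable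
component: its unstable component is `-∫_t^∞ T(t,τ) Q(τ) G(τ) dτ`. -/
theorem exists_mild [CompleteSpace X] (S : IsAdmissible T P h k μ ν a b ε K q) {s B : ℝ}
    (hs : 0 ≤ s) (hB : 0 ≤ B) {G : ℝ → X} (hGc : ContinuousOn G (Ici s))
    (hG : ∀ t, s ≤ t → ‖G t‖ ≤ B * h t ^ a * (h t ^ a) ^ q) {ξ : X} (hξ : P s ξ = ξ) :
    ∃ x, IsMild T s x G ∧ P s (x s) = ξ ∧ ∀ t, s ≤ t →
      ‖x t‖ ≤ (K * μ s ^ ε * ‖ξ‖ / h s ^ a + 2 * (K * B * tailC h μ ν a ε q s)) * h t ^ a := by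
  have hK := S.K_pos.le
  have hQc : ContinuousOn (fun τ => compl P τ (G τ)) (Ici s) :=
    ((S.continuousOn_compl).mono (Ici_subset_Ici.2 hs)).clm_apply hGc
  have hdom : ∀ t τ, s ≤ t → t ≤ τ →
      ‖T t τ (compl P τ (G τ))‖ ≤ K * B * h t ^ a * tailIntegrand h μ ν a ε q τ := by
    intro t τ ht hτ
    have ht0 := hs.trans ht
    have hτ0 := ht0.trans hτ
    have h1 := (S.ν_rpow_pos hτ0).le
    have h3 : 0 ≤ (h τ ^ a) ^ q := Real.rpow_nonneg (S.weight_pos hτ0).le _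
    calc ‖T t τ (compl P τ (G τ))‖ ≤ K * ν τ ^ ε * ‖G τ‖ := S.norm_unstable_le ht0 hτ _
      _ ≤ K * ν τ ^ ε * (B * h τ ^ a * (h τ ^ a) ^ q) := by
          gcongr; exact hG τ (ht.trans hτ)
      _ = K * B * h τ ^ a * (ν τ ^ ε * (h τ ^ a) ^ q) := by ring
      _ ≤ K * B * h t ^ a * tailIntegrand h μ ν a ε q τ :=
          mul_le_mul (mul_le_mul_of_nonneg_left (S.weight_antitone ht0 hτ) (mul_nonneg hK hB))
            (S.ν_mul_le_tailIntegrand hτ0) (mul_nonneg h1 h3)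
            (mul_nonneg (mul_nonneg hK hB) (S.weight_pos ht0).le)
  have hint : ∀ t, s ≤ t → IntegrableOn (fun τ => T t τ (compl P τ (G τ))) (Ioi t) := by
    intro t ht
    refine Integrable.mono' ((S.integrableOn_tail (hs.trans ht)).const_mul (K * B * h t ^ a))
      (((S.evol.continuousOn_apply (hs.trans ht) hs hQc).mono
        fun τ hτ => ht.trans (le_of_lt hτ)).aestronglyMeasurable measurableSet_Ioi) ?_
    exact (ae_restrict_iff' measurableSet_Ioi).2
      (Eventually.of_forall fun τ hτ => hdom t τ ht (le_of_lt hτ))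
  -- the initial unstable component is minus `I`
  set I : X := ∫ τ in Ioi s, T s τ (compl P τ (G τ)) with hI
  have hIQ : compl P s I = I := by
    rw [hI, ← ContinuousLinearMap.integral_comp_comm _ (hint s le_rfl)]
    refine setIntegral_congr_fun measurableSet_Ioi fun τ hτ => ?_
    have hτ0 : 0 ≤ τ := hs.trans (le_of_lt hτ)
    simp only [S.compl_evol hs hτ0]
    congr 1
    have := DFunLike.congr_fun (S.dich.proj τ hτ0) (G τ)
    simp only [ContinuousLinearMap.comp_apply] at this
    simp [compl, this]
  have hIP : P s I = 0 := (S.dich.mem_unstableSpace_iff hs).1 ⟨I, hIQ⟩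
  have hx := S.evol.isMild_of_initial hs (ξ - I) hGc
  set x : ℝ → X := fun t => T t s ((ξ - I) + ∫ τ in s..t, T s τ (G τ)) with hxdef
  have hxs : x s = ξ - I := by simp [hxdef, S.evol.self_apply hs]
  have hPs : P s (x s) = ξ := by rw [hxs, map_sub, hξ, hIP, sub_zero]
  have hQs : compl P s (x s) = -I := by
    rw [compl_apply, hPs, hxs]; abel
  refine ⟨x, hx, hPs, fun t ht => ?_⟩
  have ht0 := hs.trans ht
  have hP := S.norm_proj_le (w := fun t => h t ^ a) hx hB
    (fun t ht => (S.weight_pos (hs.trans ht)).le)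
    (fun r t hr hrt => (div_mul_cancel₀ _ (S.weight_pos (hs.trans hr)).ne').le) hG ht
  rw [hPs] at hP
  have hQ : compl P t (x t) = -∫ τ in Ioi t, T t τ (compl P τ (G τ)) := by
    have h1 : ∫ τ in Ioi t, T t τ (compl P τ (G τ))
        = T t s (∫ τ in Ioi t, T s τ (compl P τ (G τ))) := by
      rw [← ContinuousLinearMap.integral_comp_comm _
        ((hint s le_rfl).mono_set (Ioi_subset_Ioi ht))]
      refine setIntegral_congr_fun measurableSet_Ioi fun τ hτ => ?_
      exact (S.evol.comp_apply ht0 hs (ht0.trans (le_of_lt hτ)) _).symm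
    have h2 := intervalIntegral.integral_interval_add_Ioi (hint s le_rfl)
      ((hint s le_rfl).mono_set (Ioi_subset_Ioi ht))
    have h3 := S.evol_compl_mild hx le_rfl ht
    have h4 : compl P t (x t) = T t s (T s t (compl P t (x t))) := by
      rw [S.evol.comp_apply ht0 hs ht0, S.evol.self_apply ht0]
    rw [h4, h3, hQs, hI, ← h2, h1, ← map_neg]
    congr 1
    abel
  have hQn : ‖compl P t (x t)‖ ≤ K * B * h t ^ a * tailC h μ ν a ε q s := by
    rw [hQ, norm_neg]
    refine (norm_integral_le_of_norm_le
      ((S.integrableOn_tail ht0).const_mul (K * B * h t ^ a))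
      ((ae_restrict_iff' measurableSet_Ioi).2
        (Eventually.of_forall fun τ hτ => hdom t τ ht (le_of_lt hτ)))).trans ?_
    rw [integral_const_mul]
    exact mul_le_mul_of_nonneg_left (S.tailC_antitone hs ht)
      (mul_nonneg (mul_nonneg hK hB) (S.weight_pos ht0).le)
  calc ‖x t‖ = ‖P t (x t) + compl P t (x t)‖ := by rw [add_compl_apply]
    _ ≤ ‖P t (x t)‖ + ‖compl P t (x t)‖ := norm_add_le _ _
    _ ≤ _ := add_le_add hP hQn
    _ = _ := by ring

end IsAdmissible

/-- A quantity that is bounded, and each of whose upper bounds `D` can be improved to `m + D / 2`,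
is at most `2 m`. -/
theorem le_two_mul_of_improvable {φ : ℝ → ℝ} {s m N : ℝ} (hN : ∀ t, s ≤ t → φ t ≤ N)
    (hφ : ∀ D, (∀ t, s ≤ t → φ t ≤ D) → ∀ t, s ≤ t → φ t ≤ m + D / 2) {t : ℝ} (ht : s ≤ t) :
    φ t ≤ 2 * m := by
  have hbdd : BddAbove (φ '' Ici s) := ⟨N, by rintro _ ⟨t, ht, rfl⟩; exact hN t ht⟩
  have hle : ∀ t, s ≤ t → φ t ≤ sSup (φ '' Ici s) := fun t ht => le_csSup hbdd ⟨t, ht, rfl⟩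
  have h1 : sSup (φ '' Ici s) ≤ m + sSup (φ '' Ici s) / 2 :=
    csSup_le ⟨_, t, ht, rfl⟩ (by rintro _ ⟨t, ht, rfl⟩; exact hφ _ hle t ht)
  linarith [hle t ht]

/-! ### Superlinear nonlinearities -/

/-- The condition imposed on the perturbation `g = f(·, ·, λ)` at a fixed parameter `λ`. -/
structure IsSuperlinear {E : Type*} [NormedAddCommGroup E] (g : ℝ → E → E) (c q : ℝ) : Prop where
  continuousOn : ∀ x, ContinuousOn (fun t => g t x) (Ici 0)
  map_zero : ∀ t, 0 ≤ t → g t 0 = 0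
  lipschitz : ∀ t, 0 ≤ t → ∀ x₁ x₂,
    ‖g t x₁ - g t x₂‖ ≤ c * ‖x₁ - x₂‖ * (‖x₁‖ ^ q + ‖x₂‖ ^ q)

namespace IsSuperlinear

variable {E : Type*} [NormedAddCommGroup E] {g : ℝ → E → E} {c q : ℝ}

theorem norm_le (hg : IsSuperlinear g c q) (hq : 0 < q) {t : ℝ} (ht : 0 ≤ t) (x : E) :
    ‖g t x‖ ≤ c * ‖x‖ * ‖x‖ ^ q := by
  have := hg.lipschitz t ht x 0
  simpa [hg.map_zero t ht, Real.zero_rpow hq.ne'] using this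

theorem comp_continuousOn (hg : IsSuperlinear g c q) (hq : 0 < q) {A : Set ℝ} (hA : A ⊆ Ici 0)
    {x : ℝ → E} (hx : ContinuousOn x A) : ContinuousOn (fun t => g t (x t)) A := by
  intro t₀ ht₀
  have h1 : Tendsto (fun t => g t (x t) - g t (x t₀)) (𝓝[A] t₀) (𝓝 0) := by
    have hxt : Tendsto x (𝓝[A] t₀) (𝓝 (x t₀)) := hx t₀ ht₀
    have hlim : Tendsto (fun t => c * ‖x t - x t₀‖ * (‖x t‖ ^ q + ‖x t₀‖ ^ q)) (𝓝[A] t₀)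
        (𝓝 (c * ‖x t₀ - x t₀‖ * (‖x t₀‖ ^ q + ‖x t₀‖ ^ q))) :=
      (((hxt.sub_const _).norm).const_mul c).mul
        ((hxt.norm.rpow_const (Or.inr hq.le)).add_const _)
    rw [sub_self, norm_zero, mul_zero, zero_mul] at hlim
    refine squeeze_zero_norm' ?_ hlim
    filter_upwards [self_mem_nhdsWithin] with t ht
    exact hg.lipschitz t (hA ht) _ _
  have h2 : Tendsto (fun t => g t (x t₀)) (𝓝[A] t₀) (𝓝 (g t₀ (x t₀))) :=
    ((hg.continuousOn (x t₀)) t₀ (hA ht₀)).mono_left (nhdsWithin_mono _ hA)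
  have := h1.add h2
  simpa [ContinuousWithinAt] using this

theorem norm_le_of_le (hg : IsSuperlinear g c q) (hq : 0 < q) (hc : 0 ≤ c) {t : ℝ} (ht : 0 ≤ t)
    {x : E} {N y : ℝ} (hN : 0 ≤ N) (hy : 0 ≤ y) (hx : ‖x‖ ≤ N * y) :
    ‖g t x‖ ≤ c * N ^ q * N * y * y ^ q := by
  refine (hg.norm_le hq ht x).trans ?_
  calc c * ‖x‖ * ‖x‖ ^ q ≤ c * (N * y) * (N * y) ^ q := by gcongr
    _ = c * N ^ q * N * y * y ^ q := by rw [Real.mul_rpow hN hy]; ring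

theorem lipschitz_of_le (hg : IsSuperlinear g c q) (hq : 0 < q) (hc : 0 ≤ c) {t : ℝ} (ht : 0 ≤ t)
    {x₁ x₂ : E} {N₁ N₂ y : ℝ} (hN₁ : 0 ≤ N₁) (hN₂ : 0 ≤ N₂) (hy : 0 ≤ y) (hx₁ : ‖x₁‖ ≤ N₁ * y)
    (hx₂ : ‖x₂‖ ≤ N₂ * y) :
    ‖g t x₁ - g t x₂‖ ≤ c * (N₁ ^ q + N₂ ^ q) * ‖x₁ - x₂‖ * y ^ q := by
  refine (hg.lipschitz t ht x₁ x₂).trans ?_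
  calc c * ‖x₁ - x₂‖ * (‖x₁‖ ^ q + ‖x₂‖ ^ q)
      ≤ c * ‖x₁ - x₂‖ * ((N₁ * y) ^ q + (N₂ * y) ^ q) := by gcongr
    _ = _ := by rw [Real.mul_rpow hN₁ hy, Real.mul_rpow hN₂ hy]; ring

end IsSuperlinear

/-- Forward uniqueness for the integral equation, by Gronwall's inequality. -/
theorem IsEvolutionFamily.eqOn_of_integral_eq [CompleteSpace X] {T : ℝ → ℝ → X →L[ℝ] X}
    (hT : IsEvolutionFamily T) {g : ℝ → X → X} {c q : ℝ} (hg : IsSuperlinear g c q) (hq : 0 < q)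
    (hc : 0 ≤ c) {s t : ℝ} (hs : 0 ≤ s) {x₀ : X} {x y : ℝ → X} (hx : ContinuousOn x (Icc s t))
    (hy : ContinuousOn y (Icc s t))
    (hxe : ∀ r ∈ Icc s t, x r = T r s x₀ + ∫ τ in s..r, T r τ (g τ (x τ)))
    (hye : ∀ r ∈ Icc s t, y r = T r s x₀ + ∫ τ in s..r, T r τ (g τ (y τ))) :
    EqOn x y (Icc s t) := by
  intro r₀ hr₀
  have hst : s ≤ t := hr₀.1.trans hr₀.2
  obtain ⟨M, hM0, hM⟩ := hT.exists_bound t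
  obtain ⟨R₁, hR₁⟩ := isCompact_Icc.exists_bound_of_continuousOn hx
  obtain ⟨R₂, hR₂⟩ := isCompact_Icc.exists_bound_of_continuousOn hy
  have hR₁0 : 0 ≤ R₁ := (norm_nonneg _).trans (hR₁ r₀ hr₀)
  have hR₂0 : 0 ≤ R₂ := (norm_nonneg _).trans (hR₂ r₀ hr₀)
  set L := M * (c * (R₁ ^ q + R₂ ^ q)) with hL
  have hL0 : 0 ≤ L := by positivity
  set φ : ℝ → ℝ := fun τ => ‖x τ - y τ‖ with hφ
  have hφc : ContinuousOn φ (Icc s t) := (hx.sub hy).norm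
  have hsub : Icc s t ⊆ Ici 0 := fun τ hτ => hs.trans hτ.1
  have hint : ∀ r ∈ Icc s t, ∀ z : ℝ → X, ContinuousOn z (Icc s t) →
      IntervalIntegrable (fun τ => T r τ (g τ (z τ))) volume s r := by
    intro r hr z hz
    refine ContinuousOn.intervalIntegrable ?_
    rw [uIcc_of_le hr.1]
    have hss : Icc s r ⊆ Icc s t := Icc_subset_Icc_right hr.2
    exact ((hT.continuousOn_snd (hs.trans hr.1)).mono (hss.trans hsub)).clm_apply
      ((hg.comp_continuousOn hq hsub hz).mono hss)
  have hφint : ∀ r ∈ Icc s t, IntervalIntegrable φ volume s r := fun r hr =>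
    ContinuousOn.intervalIntegrable
      (by rw [uIcc_of_le hr.1]; exact hφc.mono (Icc_subset_Icc_right hr.2))
  have hineq : ∀ r ∈ Icc s t, φ r ≤ L * ∫ τ in s..r, φ τ := by
    intro r hr
    have h1 : x r - y r = ∫ τ in s..r, (T r τ (g τ (x τ)) - T r τ (g τ (y τ))) := by
      rw [intervalIntegral.integral_sub (hint r hr x hx) (hint r hr y hy), hxe r hr, hye r hr]
      abel
    change ‖x r - y r‖ ≤ _
    rw [h1, ← intervalIntegral.integral_const_mul]
    refine intervalIntegral.norm_integral_le_of_norm_le hr.1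
      (Eventually.of_forall fun τ hτ => ?_) ((hφint r hr).const_mul L)
    have hτ' : τ ∈ Icc s t := ⟨hτ.1.le, hτ.2.trans hr.2⟩
    rw [← map_sub]
    calc ‖T r τ (g τ (x τ) - g τ (y τ))‖ ≤ M * ‖g τ (x τ) - g τ (y τ)‖ :=
          (T r τ).le_of_opNorm_le (hM r ⟨hs.trans hr.1, hr.2⟩ τ ⟨hs.trans hτ.1.le, hτ'.2⟩) _
      _ ≤ M * (c * ‖x τ - y τ‖ * (‖x τ‖ ^ q + ‖y τ‖ ^ q)) := by
          gcongr; exact hg.lipschitz τ (hs.trans hτ.1.le) _ _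
      _ ≤ M * (c * ‖x τ - y τ‖ * (R₁ ^ q + R₂ ^ q)) := by
          gcongr
          · exact hR₁ τ hτ'
          · exact hR₂ τ hτ'
      _ = L * ‖x τ - y τ‖ := by rw [hL]; ring
  have hzero := eq_zero_of_abs_deriv_le_mul_abs_self_of_eq_zero_right
    (f := fun r => ∫ τ in s..r, φ τ) (f' := φ) (K := L) (a := s) (b := t) ?_ ?_ (by simp) ?_ r₀ hr₀
  · have := hineq r₀ hr₀
    rw [hzero, mul_zero] at this
    exact sub_eq_zero.1 (norm_eq_zero.1 (le_antisymm this (norm_nonneg _)))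
  · have := intervalIntegral.continuousOn_primitive_interval'
      (hφint t ⟨hst, le_rfl⟩) left_mem_uIcc
    rwa [uIcc_of_le hst] at this
  · intro r hr
    have hr' : r ∈ Icc s t := ⟨hr.1, hr.2.le⟩
    have hmem : Icc s t ∈ 𝓝[>] r := mem_of_superset (Ioo_mem_nhdsGT hr.2)
      fun z hz => ⟨hr.1.trans hz.1.le, hz.2.le⟩
    refine intervalIntegral.integral_hasDerivWithinAt_right (t := Ioi r) (hφint r hr')
      ⟨Icc s t, hmem, hφc.aestronglyMeasurable measurableSet_Icc⟩
      ((hφc r hr').mono_of_mem_nhdsWithin hmem)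
  · intro r hr
    have hr' : r ∈ Icc s t := ⟨hr.1, hr.2.le⟩
    have h1 := hineq r hr'
    rw [Real.norm_of_nonneg (norm_nonneg _)]
    exact h1.trans (mul_le_mul_of_nonneg_left (le_abs_self _) hL0)

/-! ### Decaying solutions of the nonlinear equation -/

/-- `x` is a mild solution on `[s, ∞)` of `x' = A(t) x + g(t, x)` that decays at least like
`N h(t)^a`. -/
structure IsDecaying (T : ℝ → ℝ → X →L[ℝ] X) (g : ℝ → X → X) (h : ℝ → ℝ) (a s N : ℝ)
    (x : ℝ → X) : Prop where
  mild : IsMild T s x fun t => g t (x t)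
  bound : ∀ t, s ≤ t → ‖x t‖ ≤ N * h t ^ a

theorem IsDecaying.restrict {T : ℝ → ℝ → X →L[ℝ] X} {g : ℝ → X → X} {h : ℝ → ℝ} {a s r N : ℝ}
    {x : ℝ → X} (hx : IsDecaying T g h a s N x) (hr : s ≤ r) : IsDecaying T g h a r N x :=
  ⟨hx.mild.mono hr, fun t ht => hx.bound t (hr.trans ht)⟩

namespace IsAdmissible

variable {T : ℝ → ℝ → X →L[ℝ] X} {P : ℝ → X →L[ℝ] X} {h k μ ν : ℝ → ℝ} {a b ε K q : ℝ}

/-- A decaying mild solution whose forcing is small relative to itself, up to an error `e`, is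
controlled by its initial stable component and by `e`. -/
theorem norm_le_of_small_forcing [CompleteSpace X] (S : IsAdmissible T P h k μ ν a b ε K q)
    {s L e N δ : ℝ} {x G : ℝ → X} (hx : IsMild T s x G) (hN : ∀ t, s ≤ t → ‖x t‖ ≤ N * h t ^ a)
    (hL : 0 ≤ L) (he : 0 ≤ e) (hsmall : 2 * (K * L * tailC h μ ν a ε q s) ≤ 1 / 2)
    (hG : ∀ t, s ≤ t → ‖G t‖ ≤ (L * ‖x t‖ + e * h t ^ a) * (h t ^ a) ^ q)
    (hδ : δ = 2 * (K * μ s ^ ε * ‖P s (x s)‖ / h s ^ a) + 4 * (K * e * tailC h μ ν a ε q s))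
    {t : ℝ} (ht : s ≤ t) :
    ‖x t‖ ≤ δ * h t ^ a ∧ ‖P t (x t)‖ ≤ δ * h t ^ a ∧
      ‖compl P t (x t)‖ ≤ K * (L * δ + e) * tailC h μ ν a ε q s * h t ^ a ∧
      ‖compl P t (x t)‖ ≤ δ * h t ^ a := by
  have hs := hx.nonneg
  have hpos : ∀ t, s ≤ t → 0 < h t ^ a := fun t ht => S.weight_pos (hs.trans ht)
  have hK := S.K_pos.le
  have hC := (S.tailC_pos hs).le
  set C := tailC h μ ν a ε q s with hCdef
  set m := K * μ s ^ ε * ‖P s (x s)‖ / h s ^ a with hm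
  have hm0 : 0 ≤ m := div_nonneg (mul_nonneg (mul_nonneg hK (zero_le_one.trans
    (S.one_le_μ_rpow hs))) (norm_nonneg _)) (hpos s le_rfl).le
  have hstep : ∀ D, (∀ t, s ≤ t → ‖x t‖ ≤ D * h t ^ a) → ∀ t, s ≤ t →
      ‖P t (x t)‖ ≤ (m + K * (L * D + e) * C) * h t ^ a ∧
      ‖compl P t (x t)‖ ≤ K * (L * D + e) * C * h t ^ a := by
    intro D hD t ht
    have hD0 : 0 ≤ D := nonneg_of_mul_nonneg_left ((norm_nonneg _).trans (hD s le_rfl))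
      (hpos s le_rfl)
    have hB : 0 ≤ L * D + e := by positivity
    have hG' : ∀ t, s ≤ t → ‖G t‖ ≤ (L * D + e) * h t ^ a * (h t ^ a) ^ q := by
      intro t ht
      refine (hG t ht).trans (mul_le_mul_of_nonneg_right ?_ (Real.rpow_nonneg (hpos t ht).le _))
      have := mul_le_mul_of_nonneg_left (hD t ht) hL
      linarith
    constructor
    · have := S.norm_proj_le (w := fun t => h t ^ a) hx hB (fun t ht => (hpos t ht).le)
        (fun r t hr _ => (div_mul_cancel₀ _ (hpos r hr).ne').le) hG' ht
      refine this.trans_eq ?_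
      rw [hm]; ring
    · exact S.norm_compl_le (w := fun t => h t ^ a) hx hN hB (fun t ht => (hpos t ht).le)
        (fun r t hr hrt => S.weight_antitone (hs.trans hr) hrt) hG' ht
  have hxδ : ∀ t, s ≤ t → ‖x t‖ ≤ δ * h t ^ a := by
    intro t ht
    rw [← div_le_iff₀ (hpos t ht), hδ,
      show 2 * m + 4 * (K * e * C) = 2 * (m + 2 * (K * e * C)) by ring]
    refine le_two_mul_of_improvable (φ := fun t => ‖x t‖ / h t ^ a) (N := N)
      (fun t ht => (div_le_iff₀ (hpos t ht)).2 (hN t ht)) (fun D hD t ht => ?_) ht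
    have hD0 : 0 ≤ D := (div_nonneg (norm_nonneg _) (hpos s le_rfl).le).trans (hD s le_rfl)
    obtain ⟨h1, h2⟩ := hstep D (fun t ht => (div_le_iff₀ (hpos t ht)).1 (hD t ht)) t ht
    rw [div_le_iff₀ (hpos t ht)]
    calc ‖x t‖ = ‖P t (x t) + compl P t (x t)‖ := by rw [add_compl_apply]
      _ ≤ _ := (norm_add_le _ _).trans (add_le_add h1 h2)
      _ = (m + 2 * (K * e * C) + 2 * (K * L * C) * D) * h t ^ a := by ring
      _ ≤ (m + 2 * (K * e * C) + 1 / 2 * D) * h t ^ a := by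
          have := (hpos t ht).le
          gcongr
      _ = _ := by ring
  obtain ⟨h1, h2⟩ := hstep δ hxδ t ht
  have hδ0 : 0 ≤ δ := nonneg_of_mul_nonneg_left ((norm_nonneg _).trans (hxδ s le_rfl))
    (hpos s le_rfl)
  have h3 : K * (L * δ + e) * C ≤ δ / 4 + K * e * C := by
    have := mul_le_mul_of_nonneg_right hsmall hδ0
    nlinarith
  have h4 : 0 ≤ K * e * C := by positivity
  refine ⟨hxδ t ht, h1.trans (mul_le_mul_of_nonneg_right ?_ (hpos t ht).le), h2,
    h2.trans (mul_le_mul_of_nonneg_right ?_ (hpos t ht).le)⟩ <;> linarith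

/-- Comparison of decaying solutions `x₁`, `x₂` of two equations whose nonlinearities differ by at
most `e h^{a(q+1)}` along `x₂`. -/
theorem norm_sub_le_of_isDecaying [CompleteSpace X] (S : IsAdmissible T P h k μ ν a b ε K q)
    {g₁ g₂ : ℝ → X → X} {c s N₁ N₂ e δ : ℝ} {x₁ x₂ : ℝ → X} (hg : IsSuperlinear g₁ c q)
    (hc : 0 ≤ c) (h₁ : IsDecaying T g₁ h a s N₁ x₁) (h₂ : IsDecaying T g₂ h a s N₂ x₂)
    (hs₁ : 4 * (K * c * N₁ ^ q * tailC h μ ν a ε q s) ≤ 1 / 2)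
    (hs₂ : 4 * (K * c * N₂ ^ q * tailC h μ ν a ε q s) ≤ 1 / 2) (he : 0 ≤ e)
    (hge : ∀ t, s ≤ t → ‖g₁ t (x₂ t) - g₂ t (x₂ t)‖ ≤ e * h t ^ a * (h t ^ a) ^ q)
    (hδ : δ = 2 * (K * μ s ^ ε * ‖P s (x₁ s) - P s (x₂ s)‖ / h s ^ a)
      + 4 * (K * e * tailC h μ ν a ε q s))
    {t : ℝ} (ht : s ≤ t) :
    ‖x₁ t - x₂ t‖ ≤ δ * h t ^ a ∧ ‖P t (x₁ t) - P t (x₂ t)‖ ≤ δ * h t ^ a ∧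
      ‖compl P t (x₁ t) - compl P t (x₂ t)‖
        ≤ K * (c * (N₁ ^ q + N₂ ^ q) * δ + e) * tailC h μ ν a ε q s * h t ^ a ∧
      ‖compl P t (x₁ t) - compl P t (x₂ t)‖ ≤ δ * h t ^ a := by
  have hs := h₁.mild.nonneg
  have hpos : ∀ t, s ≤ t → 0 < h t ^ a := fun t ht => S.weight_pos (hs.trans ht)
  have hN₁ : 0 ≤ N₁ := nonneg_of_mul_nonneg_left ((norm_nonneg _).trans (h₁.bound s le_rfl))
    (hpos s le_rfl)
  have hN₂ : 0 ≤ N₂ := nonneg_of_mul_nonneg_left ((norm_nonneg _).trans (h₂.bound s le_rfl))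
    (hpos s le_rfl)
  simp only [← map_sub] at hδ ⊢
  refine S.norm_le_of_small_forcing (N := N₁ + N₂) (h₁.mild.sub S.evol h₂.mild)
    (fun t ht => ?_) (by positivity) he ?_ (fun t ht => ?_) hδ ht
  · rw [add_mul]
    exact (norm_sub_le _ _).trans (add_le_add (h₁.bound t ht) (h₂.bound t ht))
  · linarith
  · have h3 := hg.lipschitz_of_le S.q_pos hc (hs.trans ht) hN₁ hN₂ (hpos t ht).le
      (h₁.bound t ht) (h₂.bound t ht)
    calc ‖g₁ t (x₁ t) - g₂ t (x₂ t)‖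
        = ‖(g₁ t (x₁ t) - g₁ t (x₂ t)) + (g₁ t (x₂ t) - g₂ t (x₂ t))‖ := by
          rw [sub_add_sub_cancel]
      _ ≤ _ := (norm_add_le _ _).trans (add_le_add h3 (hge t ht))
      _ = _ := by ring

/-- Existence of a decaying solution with prescribed small stable component, by the contraction
principle on `{x : ‖x(t)‖ ≤ N h(t)^a}` with the supremum distance. -/
theorem exists_isDecaying [CompleteSpace X] (S : IsAdmissible T P h k μ ν a b ε K q)
    {g : ℝ → X → X} {c s N : ℝ} (hg : IsSuperlinear g c q) (hc : 0 ≤ c) (hs : 0 ≤ s) (hN : 0 ≤ N)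
    (hsmall : 4 * (K * c * N ^ q * tailC h μ ν a ε q s) ≤ 1 / 2) {ξ : X} (hξ : P s ξ = ξ)
    (hξN : K * μ s ^ ε * ‖ξ‖ / h s ^ a ≤ N / 2) :
    ∃ x, IsDecaying T g h a s N x ∧ P s (x s) = ξ := by
  have hpos : ∀ t, s ≤ t → 0 < h t ^ a := fun t ht => S.weight_pos (hs.trans ht)
  have hK := S.K_pos.le
  have hC := (S.tailC_pos hs).le
  set C := tailC h μ ν a ε q s with hCdef
  let B : Set (BoundedContinuousFunction ℝ X) := {x | ∀ t, s ≤ t → ‖x t‖ ≤ N * h t ^ a}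
  have hBclosed : IsClosed B := by
    have : B = ⋂ t, ⋂ (_ : s ≤ t), {x | ‖x t‖ ≤ N * h t ^ a} := by ext; simp [B]
    rw [this]
    refine isClosed_iInter fun t => isClosed_iInter fun _ => ?_
    exact isClosed_le (continuous_eval_const t).norm
      continuous_const
  have hforce : ∀ x ∈ B, ContinuousOn (fun t => g t (x t)) (Ici s) ∧
      ∀ t, s ≤ t → ‖g t (x t)‖ ≤ c * N ^ q * N * h t ^ a * (h t ^ a) ^ q := fun x hx =>
    ⟨hg.comp_continuousOn S.q_pos (Ici_subset_Ici.2 hs) x.continuous.continuousOn, fun t ht =>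
      hg.norm_le_of_le S.q_pos hc (hs.trans ht) hN (hpos t ht).le (hx t ht)⟩
  have hsol : ∀ x ∈ B, ∃ y : ℝ → X, IsMild T s y (fun t => g t (x t)) ∧ P s (y s) = ξ ∧
      ∀ t, s ≤ t → ‖y t‖ ≤ N * h t ^ a := by
    intro x hx
    obtain ⟨y, hy, hyP, hyb⟩ := S.exists_mild hs (by positivity) (hforce x hx).1 (hforce x hx).2 hξ
    refine ⟨y, hy, hyP, fun t ht => (hyb t ht).trans
      (mul_le_mul_of_nonneg_right ?_ (hpos t ht).le)⟩
    have := mul_le_mul_of_nonneg_right hsmall hN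
    rw [← hCdef]
    nlinarith
  choose! y hy hyP hyb using hsol
  -- a solution on `[s, ∞)` is made a function on `ℝ` by freezing it before time `s`
  have hext : ∀ x ∈ B, ∃ z : BoundedContinuousFunction ℝ X, ∀ t, z t = y x (max s t) := by
    intro x hx
    have hc : Continuous fun t => y x (max s t) :=
      (hy x hx).continuousOn.comp_continuous (continuous_const.max continuous_id)
        fun t => le_max_left s t
    refine ⟨BoundedContinuousFunction.ofNormedAddCommGroup _ hc N fun t => ?_, fun t => rfl⟩
    refine (hyb x hx _ (le_max_left s t)).trans ?_
    exact mul_le_of_le_one_right hN (S.weight_le_one (hs.trans (le_max_left s t)))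
  choose! F hF using hext
  have hFB : MapsTo F B B := by
    intro x hx t ht
    rw [hF x hx, max_eq_right ht]
    exact hyb x hx t ht
  have hcontr : ContractingWith (1 / 2) (hFB.restrict F B B) := by
    refine ⟨by rw [div_lt_one] <;> norm_num, LipschitzWith.of_dist_le_mul ?_⟩
    rintro ⟨x, hx⟩ ⟨x', hx'⟩
    change dist (F x) (F x') ≤ (1 / 2 : NNReal) * dist x x'
    rw [BoundedContinuousFunction.dist_le (by positivity)]
    intro t
    rw [hF x hx, hF x' hx', dist_eq_norm]
    set r := max s t with hr
    have hsr : s ≤ r := le_max_left s t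
    set d := dist x x' with hd
    have hd0 : 0 ≤ d := dist_nonneg
    have hmild := (hy x hx).sub S.evol (hy x' hx')
    have hBd : 0 ≤ 2 * c * N ^ q * d := by positivity
    have hG : ∀ t, s ≤ t → ‖g t (x t) - g t (x' t)‖ ≤ 2 * c * N ^ q * d * 1 * (h t ^ a) ^ q := by
      intro t ht
      have hy0 : 0 ≤ (h t ^ a) ^ q := Real.rpow_nonneg (hpos t ht).le _
      have h1 : ‖x t - x' t‖ ≤ d := by
        rw [← dist_eq_norm]; exact BoundedContinuousFunction.dist_coe_le_dist t
      refine (hg.lipschitz_of_le S.q_pos hc (hs.trans ht) hN hN (hpos t ht).le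
        (hx t ht) (hx' t ht)).trans ?_
      calc c * (N ^ q + N ^ q) * ‖x t - x' t‖ * (h t ^ a) ^ q
          ≤ c * (N ^ q + N ^ q) * d * (h t ^ a) ^ q := by gcongr
        _ = _ := by ring
    have h1 := S.norm_proj_le (w := fun _ => 1) hmild hBd (fun _ _ => zero_le_one)
      (fun r t hr hrt => by
        rw [mul_one]
        exact (div_le_one (hpos r hr)).2 (S.weight_antitone (hs.trans hr) hrt)) hG hsr
    have h2 := S.norm_compl_le (w := fun _ => 1) (N := N + N) hmild
      (fun t ht => by
        rw [add_mul]
        exact (norm_sub_le _ _).trans (add_le_add (hyb x hx t ht) (hyb x' hx' t ht)))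
      hBd (fun _ _ => zero_le_one) (fun _ _ _ _ => le_rfl) hG hsr
    rw [map_sub (P s), hyP x hx, hyP x' hx', sub_self, norm_zero, mul_zero, zero_add] at h1
    calc ‖y x r - y x' r‖ = ‖P r (y x r - y x' r) + compl P r (y x r - y x' r)‖ := by
          rw [add_compl_apply]
      _ ≤ _ := (norm_add_le _ _).trans (add_le_add h1 h2)
      _ = 4 * (K * c * N ^ q * C) * d := by rw [hCdef]; ring
      _ ≤ 1 / 2 * d := by gcongr
      _ = _ := by simp
  have h0 : (0 : BoundedContinuousFunction ℝ X) ∈ B := fun t ht => by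
    simpa using mul_nonneg hN (hpos t ht).le
  obtain ⟨x, hx, hfix, -⟩ := hcontr.exists_fixedPoint' hBclosed.isComplete hFB h0 (edist_ne_top _ _)
  have hxy : ∀ t, s ≤ t → y x t = x t := fun t ht => by
    have := hF x hx t
    rw [hfix, max_eq_right ht] at this
    exact this.symm
  exact ⟨x, ⟨(hy x hx).congr (fun t ht => (hxy t ht).symm) fun _ _ => rfl, hx⟩,
    (hxy s le_rfl) ▸ hyP x hx⟩

end IsAdmissible

/-! ### Solutions of the split equation -/

section Semiflow

variable {T : ℝ → ℝ → X →L[ℝ] X} {P : ℝ → X →L[ℝ] X} {h k μ ν : ℝ → ℝ} {a b ε K q : ℝ}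
  {g : ℝ → X → X} {c : ℝ}

/-- Adding the two components of a split solution gives a solution of the unsplit integral
equation. -/
theorem IsAdmissible.add_eq_of_isSplitSolution [CompleteSpace X]
    (S : IsAdmissible T P h k μ ν a b ε K q) (hg : IsSuperlinear g c q) {s t : ℝ} (hs : 0 ≤ s)
    {u v : ℝ → X} (huv : IsSplitSolution T P g s t u v) :
    ∀ r ∈ Icc s t, u r + v r = T r s (u s + v s) + ∫ τ in s..r, T r τ (g τ (u τ + v τ)) := by
  intro r hr
  have hsub : Icc s r ⊆ Ici 0 := fun τ hτ => hs.trans hτ.1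
  have hG : ContinuousOn (fun τ => g τ (u τ + v τ)) (Icc s r) :=
    hg.comp_continuousOn S.q_pos hsub
      ((huv.continuousOn_u.add huv.continuousOn_v).mono (Icc_subset_Icc_right hr.2))
  have hTc := (S.evol.continuousOn_snd (hs.trans hr.1)).mono hsub
  have hint : ∀ R : ℝ → X →L[ℝ] X, ContinuousOn R (Ici 0) →
      IntervalIntegrable (fun τ => T r τ (R τ (g τ (u τ + v τ)))) volume s r := fun R hR =>
    ContinuousOn.intervalIntegrable
      (by rw [uIcc_of_le hr.1]; exact hTc.clm_apply ((hR.mono hsub).clm_apply hG))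
  have hsum : ∫ τ in s..r, T r τ (g τ (u τ + v τ))
      = (∫ τ in s..r, T r τ (P τ (g τ (u τ + v τ))))
        + ∫ τ in s..r, T r τ (compl P τ (g τ (u τ + v τ))) := by
    rw [← intervalIntegral.integral_add (hint P S.continuousOn_proj)
      (hint (compl P) S.continuousOn_compl)]
    refine intervalIntegral.integral_congr fun τ _ => ?_
    simp only [← map_add, add_compl_apply]
  rw [hsum, map_add, huv.eq_u r hr, huv.eq_v r hr]
  abel

/-- The semiflow along a mild solution. -/
theorem IsAdmissible.semiflow_of_isMild [CompleteSpace X] (S : IsAdmissible T P h k μ ν a b ε K q)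
    {s : ℝ} {x : ℝ → X} (hx : IsMild T s x fun t => g t (x t)) {κ : ℝ} (hκ : 0 ≤ κ) :
    Semiflow T P g κ (s, P s (x s), compl P s (x s))
      (s + κ, P (s + κ) (x (s + κ)), compl P (s + κ) (x (s + κ))) := by
  have hs := hx.nonneg
  have hsub : Icc s (s + κ) ⊆ Ici 0 := fun τ hτ => hs.trans hτ.1
  have hxc := hx.continuousOn.mono (Icc_subset_Ici_self : Icc s (s + κ) ⊆ Ici s)
  refine ⟨hκ, hs, fun t => P t (x t), fun t => compl P t (x t), ⟨?_, ?_, ?_, ?_, ?_, ?_⟩, rfl, rfl⟩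
  · exact (S.continuousOn_proj.mono hsub).clm_apply hxc
  · exact (S.continuousOn_compl.mono hsub).clm_apply hxc
  · exact fun r _ => ⟨_, rfl⟩
  · exact fun r _ => ⟨_, rfl⟩
  · intro r hr
    simp only [add_compl_apply]
    exact S.proj_mild hx le_rfl hr.1
  · intro r hr
    simp only [add_compl_apply]
    exact S.compl_mild hx le_rfl hr.1

/-- The value of the semiflow is determined by any mild solution with the same initial value. -/
theorem IsAdmissible.eq_of_semiflow [CompleteSpace X] (S : IsAdmissible T P h k μ ν a b ε K q)
    (hg : IsSuperlinear g c q) (hc : 0 ≤ c) {s : ℝ} {x : ℝ → X}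
    (hx : IsMild T s x fun t => g t (x t)) {ξ η : X} (hx₀ : ξ + η = x s) {κ : ℝ}
    {p : ℝ × X × X} (hp : Semiflow T P g κ (s, ξ, η) p) :
    p = (s + κ, P (s + κ) (x (s + κ)), compl P (s + κ) (x (s + κ))) := by
  obtain ⟨hκ, hs, u, v, huv, hp₀, rfl⟩ := hp
  simp only [Prod.mk.injEq, true_and] at hp₀ huv hs ⊢
  obtain ⟨hξ, hη⟩ := hp₀
  have hmem : s + κ ∈ Icc s (s + κ) := ⟨by linarith, le_rfl⟩
  have heq := S.evol.eqOn_of_integral_eq hg S.q_pos hc hs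
    (huv.continuousOn_u.add huv.continuousOn_v) (hx.continuousOn.mono Icc_subset_Ici_self)
    (x₀ := x s) (fun r hr => by
      have := S.add_eq_of_isSplitSolution hg hs huv r hr
      rwa [← hξ, ← hη, hx₀] at this)
    (fun r hr => hx.eq s r le_rfl hr.1) hmem
  have h1 : 0 ≤ s + κ := by linarith
  have hu := (S.dich.mem_stableSpace_iff h1).1 (huv.mem_stable _ hmem)
  have hv := (S.dich.mem_unstableSpace_iff h1).1 (huv.mem_unstable _ hmem)
  rw [← heq]
  simp [compl, hu, hv]

/-- Solutions on the bounded intervals `[s, s + κ]` glue to a mild solution on `[s, ∞)`. -/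
theorem IsEvolutionFamily.exists_isMild_of_forall [CompleteSpace X] (hT : IsEvolutionFamily T)
    (hg : IsSuperlinear g c q) (hq : 0 < q) (hc : 0 ≤ c) {s : ℝ} (hs : 0 ≤ s) (x₀ : X)
    (H : ∀ κ, 0 ≤ κ → ∃ y, ContinuousOn y (Icc s (s + κ)) ∧
      ∀ r ∈ Icc s (s + κ), y r = T r s x₀ + ∫ τ in s..r, T r τ (g τ (y τ))) :
    ∃ x, IsMild T s x (fun t => g t (x t)) ∧ x s = x₀ := by
  choose! y hyc hye using H
  set x : ℝ → X := fun t => y (t - s) t with hx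
  have hxy : ∀ κ, 0 ≤ κ → EqOn x (y κ) (Icc s (s + κ)) := by
    intro κ hκ t ht
    have ht0 : 0 ≤ t - s := sub_nonneg.2 ht.1
    have hss : Icc s t ⊆ Icc s (s + κ) := Icc_subset_Icc_right ht.2
    have hst : Icc s t ⊆ Icc s (s + (t - s)) := by rw [add_sub_cancel]
    exact hT.eqOn_of_integral_eq hg hq hc hs ((hyc _ ht0).mono hst) ((hyc κ hκ).mono hss)
      (fun r hr => hye _ ht0 r (hst hr)) (fun r hr => hye κ hκ r (hss hr)) ⟨ht.1, le_rfl⟩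
  have hxc : ContinuousOn x (Ici s) := by
    intro t ht
    have ht' : s ≤ t := ht
    have hκ : 0 ≤ t - s + 1 := by linarith
    have hc := ((hyc _ hκ).congr (hxy _ hκ)) t ⟨ht', by linarith⟩
    refine hc.mono_of_mem_nhdsWithin ?_
    rw [← Ici_inter_Iic]
    exact inter_mem self_mem_nhdsWithin (mem_nhdsWithin_of_mem_nhds (Iic_mem_nhds (by linarith)))
  have hG := hg.comp_continuousOn hq (Ici_subset_Ici.2 hs) hxc
  have hxe : ∀ t, s ≤ t → x t = T t s x₀ + ∫ τ in s..t, T t τ (g τ (x τ)) := by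
    intro t ht
    have hκ : 0 ≤ t - s := by linarith
    have hst : Icc s t ⊆ Icc s (s + (t - s)) := by rw [add_sub_cancel]
    have h1 := hye _ hκ t (hst ⟨ht, le_rfl⟩)
    rw [hxy _ hκ (hst ⟨ht, le_rfl⟩), h1]
    congr 1
    refine intervalIntegral.integral_congr fun τ hτ => ?_
    rw [uIcc_of_le ht] at hτ
    simp only [hxy _ hκ (hst hτ)]
  refine ⟨x, (hT.isMild_of_initial hs x₀ hG).congr (fun t ht => ?_) fun _ _ => rfl, ?_⟩
  · rw [hxe t ht, map_add, hT.map_integral hs le_rfl ht hs _ hG]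
    congr 1
    refine intervalIntegral.integral_congr fun τ hτ => ?_
    rw [uIcc_of_le ht] at hτ
    exact (hT.comp_apply (hs.trans ht) hs (hs.trans hτ.1) _).symm
  · rw [hxe s le_rfl, intervalIntegral.integral_same, add_zero, hT.self_apply hs]

end Semiflow

/-! ### An a priori bound -/

/-- A mild solution that is dominated by its stable component, and whose initial stable component
is small, decays like `h^a`. The majorant `N + ∫_s^t ψ` of `‖P(t) x(t)‖ h(t)^{-a}` is continuous,
and it cannot take the value `2 N`. -/
theorem IsAdmissible.norm_proj_le_of_dominated [CompleteSpace X] {T : ℝ → ℝ → X →L[ℝ] X}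
    {P : ℝ → X →L[ℝ] X} {h k μ ν : ℝ → ℝ} {a b ε K q : ℝ} {g : ℝ → X → X} {c : ℝ}
    (S : IsAdmissible T P h k μ ν a b ε K q) (hg : IsSuperlinear g c q) (hc : 0 ≤ c) {s N : ℝ}
    {x : ℝ → X} (hx : IsMild T s x fun t => g t (x t)) (hN : 0 < N)
    (hdom : ∀ t, s ≤ t → ‖x t‖ ≤ 2 * ‖P t (x t)‖)
    (hx₀ : K * μ s ^ ε * ‖P s (x s)‖ / h s ^ a ≤ N)
    (hsmall : 4 * (K * c * (4 * N) ^ q * tailC h μ ν a ε q s) ≤ 1 / 2) {t : ℝ} (ht : s ≤ t) :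
    ‖P t (x t)‖ ≤ 2 * N * h t ^ a := by
  have hs := hx.nonneg
  have hpos : ∀ t, s ≤ t → 0 < h t ^ a := fun t ht => S.weight_pos (hs.trans ht)
  have hK := S.K_pos.le
  have hq := S.q_pos
  have hM : ∀ t, s ≤ t → 0 ≤ μ t ^ ε := fun t ht => zero_le_one.trans (S.one_le_μ_rpow (hs.trans ht))
  set ψ : ℝ → ℝ := fun τ =>
    ((h τ ^ a)⁻¹ * μ τ ^ ε) * (K * c * (2 * ‖P τ (x τ)‖) * (2 * ‖P τ (x τ)‖) ^ q) with hψ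
  have hψ0 : ∀ τ, s ≤ τ → 0 ≤ ψ τ := fun τ hτ =>
    mul_nonneg (mul_nonneg (inv_nonneg.2 (hpos τ hτ).le) (hM τ hτ)) (by positivity)
  have hPx : ContinuousOn (fun τ => P τ (x τ)) (Ici s) :=
    (S.continuousOn_proj.mono (Ici_subset_Ici.2 hs)).clm_apply hx.continuousOn
  have hψint : ∀ t, s ≤ t → IntervalIntegrable ψ volume s t := by
    intro t ht
    have hmono : MonotoneOn (fun τ => (h τ ^ a)⁻¹ * μ τ ^ ε) (uIcc s t) := by
      rw [uIcc_of_le ht]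
      intro r hr r' hr' hrr'
      have h1 := inv_anti₀ (hpos r' hr'.1) (S.weight_antitone (hs.trans hr.1) hrr')
      have h2 : μ r ^ ε ≤ μ r' ^ ε := Real.rpow_le_rpow (S.rate_μ.pos r (hs.trans hr.1)).le
        (S.rate_μ.monotoneOn (hs.trans hr.1) (hs.trans hr'.1) hrr') S.dich.ε_nonneg
      exact mul_le_mul h1 h2 (hM r hr.1) (inv_nonneg.2 (hpos r' hr'.1).le)
    refine hmono.intervalIntegrable.mul_continuousOn ?_
    rw [uIcc_of_le ht]
    have h1 : ContinuousOn (fun τ => 2 * ‖P τ (x τ)‖) (Icc s t) :=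
      (continuousOn_const.mul hPx.norm).mono Icc_subset_Ici_self
    exact (continuousOn_const.mul h1).mul (h1.rpow_const fun _ _ => Or.inr hq.le)
  set Θ : ℝ → ℝ := fun t => N + ∫ τ in s..t, ψ τ with hΘ
  have hle : ∀ t, s ≤ t → ‖P t (x t)‖ ≤ Θ t * h t ^ a := by
    intro t ht
    rw [S.proj_mild hx le_rfl ht, hΘ, add_mul]
    refine (norm_add_le _ _).trans (add_le_add ?_ ?_)
    · have h1 := S.norm_stable_le hs ht (P s (x s))
      rw [show P s (P s (x s)) = P s (x s) from DFunLike.congr_fun (S.dich.proj s hs) _] at h1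
      calc _ ≤ _ := h1
        _ = K * μ s ^ ε * ‖P s (x s)‖ / h s ^ a * h t ^ a := by ring
        _ ≤ N * h t ^ a := mul_le_mul_of_nonneg_right hx₀ (hpos t ht).le
    · rw [← intervalIntegral.integral_mul_const]
      refine intervalIntegral.norm_integral_le_of_norm_le ht
        (Eventually.of_forall fun τ hτ => ?_) ((hψint t ht).mul_const _)
      have hτ1 := hτ.1.le
      have hτ0 := hs.trans hτ1
      have h2 : 0 ≤ h t ^ a / h τ ^ a := div_nonneg (hpos t ht).le (hpos τ hτ1).le
      have h3 := hM τ hτ1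
      calc ‖T t τ (P τ (g τ (x τ)))‖
          ≤ K * (h t ^ a / h τ ^ a) * μ τ ^ ε * ‖g τ (x τ)‖ := S.norm_stable_le hτ0 hτ.2 _
        _ ≤ K * (h t ^ a / h τ ^ a) * μ τ ^ ε
            * (c * (2 * ‖P τ (x τ)‖) * (2 * ‖P τ (x τ)‖) ^ q) := by
            gcongr
            refine (hg.norm_le hq hτ0 _).trans ?_
            have := hdom τ hτ1
            gcongr
        _ = ψ τ * h t ^ a := by rw [hψ]; ring
  have hΘc : ∀ t, s ≤ t → ContinuousOn Θ (Icc s t) := by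
    intro t ht
    have := intervalIntegral.continuousOn_primitive_interval' (hψint t ht) left_mem_uIcc
    rw [uIcc_of_le ht] at this
    exact continuousOn_const.add this
  have hlt : Θ t ≤ 2 * N := by
    by_contra! hcon
    obtain ⟨r, hr, hrN⟩ := intermediate_value_Icc ht (hΘc t ht)
      (show 2 * N ∈ Icc (Θ s) (Θ t) from ⟨by simp [hΘ]; linarith, hcon.le⟩)
    have hbd : ∀ τ, s ≤ τ → τ ≤ r → ‖P τ (x τ)‖ ≤ 2 * N * h τ ^ a := by
      intro τ hτ hτr
      refine (hle τ hτ).trans (mul_le_mul_of_nonneg_right ?_ (hpos τ hτ).le)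
      rw [← hrN, hΘ]
      refine (add_le_add_iff_left N).2 ?_
      refine intervalIntegral.integral_mono_interval le_rfl hτ hτr ?_ (hψint r hr.1)
      exact (ae_restrict_iff' measurableSet_Ioc).2
        (Eventually.of_forall fun z hz => hψ0 z hz.1.le)
    have hint : ∫ τ in s..r, ψ τ ≤ K * c * (4 * N) * (4 * N) ^ q * tailC h μ ν a ε q s := by
      calc ∫ τ in s..r, ψ τ
          ≤ ∫ τ in s..r, K * c * (4 * N) * (4 * N) ^ q * tailIntegrand h μ ν a ε q τ := by
            refine intervalIntegral.integral_mono_on hr.1 (hψint r hr.1)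
              ((S.intervalIntegrable_tail hs hr.1).const_mul _) fun τ hτ => ?_
            have hp := hpos τ hτ.1
            have h1 : 2 * ‖P τ (x τ)‖ ≤ 4 * N * h τ ^ a := by linarith [hbd τ hτ.1 hτ.2]
            have h3 := hM τ hτ.1
            calc ψ τ ≤ ((h τ ^ a)⁻¹ * μ τ ^ ε)
                  * (K * c * (4 * N * h τ ^ a) * (4 * N * h τ ^ a) ^ q) := by
                  simp only [hψ]; gcongr
              _ = K * c * (4 * N) * (4 * N) ^ q * (μ τ ^ ε * (h τ ^ a) ^ q) := by
                  rw [Real.mul_rpow (by positivity) hp.le]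
                  field_simp
              _ ≤ _ := mul_le_mul_of_nonneg_left (S.μ_mul_le_tailIntegrand (hs.trans hτ.1))
                  (by positivity)
        _ ≤ _ := by
            rw [intervalIntegral.integral_const_mul]
            exact mul_le_mul_of_nonneg_left (S.integral_tail_le hs hr.1) (by positivity)
    have h4 : K * c * (4 * N) * (4 * N) ^ q * tailC h μ ν a ε q s ≤ N / 2 := by
      have := mul_le_mul_of_nonneg_right hsmall hN.le
      nlinarith
    have h5 : N + ∫ τ in s..r, ψ τ = 2 * N := hrN
    linarith
  exact (hle t ht).trans (mul_le_mul_of_nonneg_right hlt (hpos t ht).le)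

/-! ### The admissible radius -/

/-- The weighted size `K h(s)^{-a} μ(s)^ε β(s)^{-ε}` of the linear solutions that start in `Z_β` at
time `s`. -/
def radius (h k μ ν : ℝ → ℝ) (a b ε K q s : ℝ) : ℝ :=
  K * μ s ^ ε * (betaPow h k μ ν a b ε q s)⁻¹ / h s ^ a

namespace IsAdmissible

variable {T : ℝ → ℝ → X →L[ℝ] X} {P : ℝ → X →L[ℝ] X} {h k μ ν : ℝ → ℝ} {a b ε K q : ℝ}

theorem betaPow_pos (S : IsAdmissible T P h k μ ν a b ε K q) {s : ℝ} (hs : 0 ≤ s) :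
    0 < betaPow h k μ ν a b ε q s :=
  mul_pos (mul_pos (mul_pos (Real.rpow_pos_of_pos (S.rate_k.pos s hs) _)
    (Real.rpow_pos_of_pos (S.rate_h.pos s hs) _)) (Real.rpow_pos_of_pos (S.rate_μ.pos s hs) _))
    (Real.rpow_pos_of_pos (S.tailC_pos hs) _)

theorem betaPow_rpow (S : IsAdmissible T P h k μ ν a b ε K q) {s : ℝ} (hs : 0 ≤ s) :
    betaPow h k μ ν a b ε q s ^ q = k s ^ b * ((h s ^ a) ^ q * h s ^ a)⁻¹
      * ((μ s ^ ε) ^ q * μ s ^ ε) * tailC h μ ν a ε q s := by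
  have h1 := S.rate_h.pos s hs
  have h2 := S.rate_k.pos s hs
  have h3 := S.rate_μ.pos s hs
  have h4 := (S.tailC_pos hs).le
  have hq := S.q_pos.ne'
  unfold betaPow
  rw [Real.mul_rpow (by positivity) (by positivity), Real.mul_rpow (by positivity) (by positivity),
    Real.mul_rpow (by positivity) (by positivity), ← Real.rpow_mul h1.le, ← Real.rpow_mul h2.le,
    ← Real.rpow_mul h3.le, ← Real.rpow_mul h4, ← Real.rpow_mul h1.le, ← Real.rpow_mul h3.le,
    ← Real.rpow_add h1, ← Real.rpow_add h3, ← Real.rpow_neg h1.le]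
  have e1 : b / q * q = b := by field_simp
  have e2 : -a * (q + 1) / q * q = -(a * q + a) := by field_simp
  have e3 : ε * (1 + 1 / q) * q = ε * q + ε := by field_simp
  have e4 : 1 / q * q = 1 := by field_simp
  rw [e1, e2, e3, e4, Real.rpow_one]

theorem radius_pos (S : IsAdmissible T P h k μ ν a b ε K q) {s : ℝ} (hs : 0 ≤ s) :
    0 < radius h k μ ν a b ε K q s :=
  div_pos (mul_pos (mul_pos S.K_pos (zero_lt_one.trans_le (S.one_le_μ_rpow hs)))
    (inv_pos.2 (S.betaPow_pos hs))) (S.weight_pos hs)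

theorem inv_betaPow_div_mono (S : IsAdmissible T P h k μ ν a b ε K q) {s t : ℝ} (hs : 0 ≤ s)
    (hst : s ≤ t) : (betaPow h k μ ν a b ε q s)⁻¹ / h s ^ a
      ≤ (betaPow h k μ ν a b ε q t)⁻¹ / h t ^ a := by
  have ht := hs.trans hst
  have h1 := inv_anti₀ (mul_pos (S.weight_pos ht) (S.betaPow_pos ht)) (S.antitone hs ht hst)
  simpa only [mul_inv, div_eq_mul_inv, mul_comm] using h1

theorem radius_mono (S : IsAdmissible T P h k μ ν a b ε K q) {s t : ℝ} (hs : 0 ≤ s)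
    (hst : s ≤ t) : radius h k μ ν a b ε K q s ≤ radius h k μ ν a b ε K q t := by
  have ht := hs.trans hst
  have h2 : μ s ^ ε ≤ μ t ^ ε := Real.rpow_le_rpow (S.rate_μ.pos s hs).le
    (S.rate_μ.monotoneOn hs ht hst) S.dich.ε_nonneg
  unfold radius
  rw [mul_div_assoc, mul_div_assoc]
  exact mul_le_mul (mul_le_mul_of_nonneg_left h2 S.K_pos.le) (S.inv_betaPow_div_mono hs hst)
    (div_nonneg (inv_nonneg.2 (S.betaPow_pos hs).le) (S.weight_pos hs).le)
    (mul_nonneg S.K_pos.le (zero_le_one.trans (S.one_le_μ_rpow ht)))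

/-- The definition of `β` makes the nonlinear terms of size `radius ^ q * C` uniformly bounded. The
spare factor `μ^ε` is what makes the invariant graph Lipschitz uniformly in time. -/
theorem radius_rpow_mul_le (S : IsAdmissible T P h k μ ν a b ε K q) {s : ℝ} (hs : 0 ≤ s) :
    radius h k μ ν a b ε K q s ^ q * tailC h μ ν a ε q s * μ s ^ ε ≤ K ^ q := by
  have hK := S.K_pos
  have hM := zero_lt_one.trans_le (S.one_le_μ_rpow hs)
  have hH := S.weight_pos hs
  have hβ := S.betaPow_pos hs
  have hC := S.tailC_pos hs
  have hk : 1 ≤ k s ^ b := Real.one_le_rpow (S.rate_k.one_le hs) S.dich.b_nonneg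
  unfold radius
  rw [Real.div_rpow (by positivity) hH.le, Real.mul_rpow (by positivity) (by positivity),
    Real.mul_rpow hK.le hM.le, Real.inv_rpow hβ.le, S.betaPow_rpow hs]
  have hMq : 0 < (μ s ^ ε) ^ q := Real.rpow_pos_of_pos hM _
  have hHq : 0 < (h s ^ a) ^ q := Real.rpow_pos_of_pos hH _
  have hKq : 0 < K ^ q := Real.rpow_pos_of_pos hK _
  have hk0 : 0 < k s ^ b := by linarith
  have : K ^ q * (μ s ^ ε) ^ q * (k s ^ b * ((h s ^ a) ^ q * h s ^ a)⁻¹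
      * ((μ s ^ ε) ^ q * μ s ^ ε) * tailC h μ ν a ε q s)⁻¹ / (h s ^ a) ^ q
      * tailC h μ ν a ε q s * μ s ^ ε = K ^ q * (h s ^ a / k s ^ b) := by
    field_simp
  rw [this]
  exact mul_le_of_le_one_right hKq.le
    ((div_le_one hk0).2 ((S.weight_le_one hs).trans hk))

/-- The smallness of `c` in the scale-free form in which it enters the estimates. -/
theorem small_mul (S : IsAdmissible T P h k μ ν a b ε K q) {c s : ℝ} (hc : 0 ≤ c)
    (hcK : 8 * (K * (K + 1)) * (c * (4 * K) ^ q) ≤ 1) (hs : 0 ≤ s) :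
    8 * (K * (K + 1)) * (c * (4 * radius h k μ ν a b ε K q s) ^ q * tailC h μ ν a ε q s * μ s ^ ε)
      ≤ 1 := by
  have hK := S.K_pos
  refine le_trans ?_ hcK
  rw [Real.mul_rpow (by norm_num) (S.radius_pos hs).le, Real.mul_rpow (by norm_num) hK.le]
  have h4 : (0 : ℝ) ≤ 4 ^ q := by positivity
  calc _ = 8 * (K * (K + 1)) * (c * 4 ^ q) *
        (radius h k μ ν a b ε K q s ^ q * tailC h μ ν a ε q s * μ s ^ ε) := by ring
    _ ≤ 8 * (K * (K + 1)) * (c * 4 ^ q) * K ^ q := by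
        refine mul_le_mul_of_nonneg_left (S.radius_rpow_mul_le hs) (by positivity)
    _ = _ := by ring

theorem small_of_le (S : IsAdmissible T P h k μ ν a b ε K q) {c s r : ℝ} (hc : 0 ≤ c)
    (hcK : 8 * (K * (K + 1)) * (c * (4 * K) ^ q) ≤ 1) (hs : 0 ≤ s) (hr : s ≤ r) :
    4 * (K * c * (4 * radius h k μ ν a b ε K q s) ^ q * tailC h μ ν a ε q r) ≤ 1 / 2 := by
  have hK := S.K_pos
  have h1 := S.small_mul hc hcK hs
  have hR : 0 ≤ (4 * radius h k μ ν a b ε K q s) ^ q :=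
    Real.rpow_nonneg (mul_nonneg (by norm_num) (S.radius_pos hs).le) _
  have hC := (S.tailC_pos hs).le
  have h2 : c * (4 * radius h k μ ν a b ε K q s) ^ q * tailC h μ ν a ε q r
      ≤ c * (4 * radius h k μ ν a b ε K q s) ^ q * tailC h μ ν a ε q s * μ s ^ ε :=
    (mul_le_mul_of_nonneg_left (S.tailC_antitone hs hr) (mul_nonneg hc hR)).trans
      (le_mul_of_one_le_right (by positivity) (S.one_le_μ_rpow hs))
  have h3 : 0 ≤ c * (4 * radius h k μ ν a b ε K q s) ^ q * tailC h μ ν a ε q s * μ s ^ ε :=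
    mul_nonneg (by positivity) (zero_le_one.trans (S.one_le_μ_rpow hs))
  have h4 := mul_le_mul_of_nonneg_left h2 hK.le
  nlinarith [mul_nonneg (mul_nonneg hK.le hK.le) h3]

end IsAdmissible

/-! ### The invariant graph -/

open Classical in
/-- The function whose graph is the stable manifold: `Φ(s, ξ)` is the unstable component at time `s`
of the decaying solution with stable component `ξ` at time `s` (and `0` if there is none). -/
def invariantMap (T : ℝ → ℝ → X →L[ℝ] X) (P : ℝ → X →L[ℝ] X) (g : ℝ → X → X) (h : ℝ → ℝ) (a : ℝ)
    (N : ℝ → ℝ) (s : ℝ) (ξ : X) : X :=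
  if H : ∃ x, IsDecaying T g h a s (N s) x ∧ P s (x s) = ξ then compl P s (H.choose s) else 0

namespace IsAdmissible

variable {T : ℝ → ℝ → X →L[ℝ] X} {P : ℝ → X →L[ℝ] X} {h k μ ν : ℝ → ℝ} {a b ε K q : ℝ}
  {g : ℝ → X → X} {c : ℝ}

theorem eq_of_isDecaying [CompleteSpace X] (S : IsAdmissible T P h k μ ν a b ε K q)
    (hg : IsSuperlinear g c q) (hc : 0 ≤ c) {s N₁ N₂ : ℝ} {x₁ x₂ : ℝ → X}
    (h₁ : IsDecaying T g h a s N₁ x₁) (h₂ : IsDecaying T g h a s N₂ x₂)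
    (hs₁ : 4 * (K * c * N₁ ^ q * tailC h μ ν a ε q s) ≤ 1 / 2)
    (hs₂ : 4 * (K * c * N₂ ^ q * tailC h μ ν a ε q s) ≤ 1 / 2)
    (h₀ : P s (x₁ s) = P s (x₂ s)) {t : ℝ} (ht : s ≤ t) : x₁ t = x₂ t := by
  have := (S.norm_sub_le_of_isDecaying hg hc h₁ h₂ hs₁ hs₂ le_rfl (e := 0) (by simp) rfl ht).1
  rw [h₀] at this
  simpa [sub_eq_zero] using this

theorem isDecaying_zero (S : IsAdmissible T P h k μ ν a b ε K q) (hg : IsSuperlinear g c q)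
    {s : ℝ} (hs : 0 ≤ s) : IsDecaying T g h a s 0 (fun _ => 0) := by
  refine ⟨⟨hs, continuousOn_const,
    hg.comp_continuousOn S.q_pos (Ici_subset_Ici.2 hs) continuousOn_const, fun r t hr hrt => ?_⟩,
    by simp⟩
  rw [map_zero, zero_add]
  refine (intervalIntegral.integral_zero_ae (Eventually.of_forall fun τ hτ => ?_)).symm
  rw [uIoc_of_le hrt] at hτ
  rw [hg.map_zero τ (hs.trans (hr.trans hτ.1.le)), map_zero]

/-- Comparison of a decaying solution with the zero solution. -/
theorem norm_proj_le_of_isDecaying [CompleteSpace X] (S : IsAdmissible T P h k μ ν a b ε K q)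
    (hg : IsSuperlinear g c q) (hc : 0 ≤ c) {s N : ℝ} {x : ℝ → X} (hx : IsDecaying T g h a s N x)
    (hsmall : 4 * (K * c * N ^ q * tailC h μ ν a ε q s) ≤ 1 / 2) {t : ℝ} (ht : s ≤ t) :
    ‖x t‖ ≤ 2 * (K * μ s ^ ε * ‖P s (x s)‖ / h s ^ a) * h t ^ a ∧
      ‖P t (x t)‖ ≤ 2 * (K * μ s ^ ε * ‖P s (x s)‖ / h s ^ a) * h t ^ a := by
  have := S.norm_sub_le_of_isDecaying hg hc hx (S.isDecaying_zero hg hx.mild.nonneg) hsmall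
    (by rw [Real.zero_rpow S.q_pos.ne']; norm_num) le_rfl (e := 0) (by simp) rfl ht
  simp only [map_zero, sub_zero, mul_zero, zero_mul, add_zero] at this
  exact ⟨this.1, this.2.1⟩

theorem invariantMap_eq [CompleteSpace X] (S : IsAdmissible T P h k μ ν a b ε K q)
    (hg : IsSuperlinear g c q) (hc : 0 ≤ c) {N : ℝ → ℝ} {s N' : ℝ} {x : ℝ → X}
    (hsmall : 4 * (K * c * N s ^ q * tailC h μ ν a ε q s) ≤ 1 / 2)
    (hsmall' : 4 * (K * c * N' ^ q * tailC h μ ν a ε q s) ≤ 1 / 2)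
    (H : ∃ y, IsDecaying T g h a s (N s) y ∧ P s (y s) = P s (x s))
    (hx : IsDecaying T g h a s N' x) :
    invariantMap T P g h a N s (P s (x s)) = compl P s (x s) := by
  rw [invariantMap, dif_pos H,
    S.eq_of_isDecaying hg hc H.choose_spec.1 hx hsmall hsmall' H.choose_spec.2 le_rfl]

theorem zero_mem_ZBeta (S : IsAdmissible T P h k μ ν a b ε K q) {s : ℝ} (hs : 0 ≤ s) :
    (s, (0 : X)) ∈ ZBeta P h k μ ν a b ε q :=
  ⟨hs, ⟨0, map_zero _⟩, by simpa using S.betaPow_pos hs⟩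

theorem two_mul_le_of_mem_ZBetaMu (S : IsAdmissible T P h k μ ν a b ε K q) {s : ℝ} {ξ : X}
    (hξ : (s, ξ) ∈ ZBetaMu P h k μ ν a b ε q (2 * K)) :
    2 * (K * μ s ^ ε * ‖ξ‖) < (betaPow h k μ ν a b ε q s)⁻¹ := by
  have hs : 0 ≤ s := hξ.1
  have hM := zero_lt_one.trans_le (S.one_le_μ_rpow hs)
  have h1 : ‖ξ‖ < (betaPow h k μ ν a b ε q s * μ s ^ ε)⁻¹ / (2 * K) := hξ.2.2
  rw [mul_inv, lt_div_iff₀ (mul_pos two_pos S.K_pos), ← div_eq_mul_inv, lt_div_iff₀ hM] at h1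
  linarith

theorem ZBetaMu_subset_ZBeta (S : IsAdmissible T P h k μ ν a b ε K q) {s : ℝ} {ξ : X}
    (hξ : (s, ξ) ∈ ZBetaMu P h k μ ν a b ε q (2 * K)) : (s, ξ) ∈ ZBeta P h k μ ν a b ε q := by
  have hs : 0 ≤ s := hξ.1
  refine ⟨hs, hξ.2.1, lt_of_le_of_lt ?_ (S.two_mul_le_of_mem_ZBetaMu hξ)⟩
  have h1 := S.norm_stable_le hs le_rfl ξ
  rw [(S.dich.mem_stableSpace_iff hs).1 hξ.2.1, S.evol.self_apply hs,
    div_self (S.weight_pos hs).ne', mul_one] at h1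
  linarith [norm_nonneg ξ]

theorem exists_isDecaying_of_mem [CompleteSpace X] (S : IsAdmissible T P h k μ ν a b ε K q)
    (hg : IsSuperlinear g c q) (hc : 0 ≤ c) (hcK : 8 * (K * (K + 1)) * (c * (4 * K) ^ q) ≤ 1)
    {s : ℝ} {ξ : X} (hξ : (s, ξ) ∈ ZBeta P h k μ ν a b ε q) :
    ∃ x, IsDecaying T g h a s (4 * radius h k μ ν a b ε K q s) x ∧ P s (x s) = ξ := by
  have hs : 0 ≤ s := hξ.1
  have hR := S.radius_pos hs
  refine S.exists_isDecaying hg hc hs (by positivity) (S.small_of_le hc hcK hs le_rfl)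
    ((S.dich.mem_stableSpace_iff hs).1 hξ.2.1) ?_
  have hM := zero_lt_one.trans_le (S.one_le_μ_rpow hs)
  have h1 : K * μ s ^ ε * ‖ξ‖ / h s ^ a ≤ radius h k μ ν a b ε K q s :=
    div_le_div_of_nonneg_right (mul_le_mul_of_nonneg_left hξ.2.2.le
      (mul_nonneg S.K_pos.le hM.le)) (S.weight_pos hs).le
  linarith

section Graph

variable [CompleteSpace X]

/-- Values of the invariant map along a decaying solution over `Z_β`. -/
theorem invariantMap_radius_eq (S : IsAdmissible T P h k μ ν a b ε K q)
    (hg : IsSuperlinear g c q) (hc : 0 ≤ c) (hcK : 8 * (K * (K + 1)) * (c * (4 * K) ^ q) ≤ 1)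
    {s N : ℝ} {x : ℝ → X} (hx : IsDecaying T g h a s N x)
    (hsmall : 4 * (K * c * N ^ q * tailC h μ ν a ε q s) ≤ 1 / 2)
    (hmem : (s, P s (x s)) ∈ ZBeta P h k μ ν a b ε q) :
    invariantMap T P g h a (fun r => 4 * radius h k μ ν a b ε K q r) s (P s (x s))
      = compl P s (x s) :=
  S.invariantMap_eq hg hc (S.small_of_le hc hcK hx.mild.nonneg le_rfl) hsmall
    (S.exists_isDecaying_of_mem hg hc hcK hmem) hx

/-- A solution that starts over `Z_{βμ}(2K)` stays over `Z_β`: its stable component is at most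
`2K (h(t)/h(s))^a μ(s)^ε ‖ξ‖`, and `h^a β^ε` is nonincreasing. -/
theorem proj_mem_ZBeta (S : IsAdmissible T P h k μ ν a b ε K q)
    (hg : IsSuperlinear g c q) (hc : 0 ≤ c) {s N : ℝ} {x : ℝ → X} (hx : IsDecaying T g h a s N x)
    (hsmall : 4 * (K * c * N ^ q * tailC h μ ν a ε q s) ≤ 1 / 2)
    (hmem : (s, P s (x s)) ∈ ZBetaMu P h k μ ν a b ε q (2 * K)) {t : ℝ} (ht : s ≤ t) :
    (t, P t (x t)) ∈ ZBeta P h k μ ν a b ε q := by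
  have hs := hx.mild.nonneg
  have ht0 := hs.trans ht
  refine ⟨ht0, ⟨_, rfl⟩, ?_⟩
  calc ‖P t (x t)‖ ≤ 2 * (K * μ s ^ ε * ‖P s (x s)‖ / h s ^ a) * h t ^ a :=
        (S.norm_proj_le_of_isDecaying hg hc hx hsmall ht).2
    _ = 2 * (K * μ s ^ ε * ‖P s (x s)‖) / h s ^ a * h t ^ a := by ring
    _ < (betaPow h k μ ν a b ε q s)⁻¹ / h s ^ a * h t ^ a :=
        mul_lt_mul_of_pos_right (div_lt_div_of_pos_right (S.two_mul_le_of_mem_ZBetaMu hmem)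
          (S.weight_pos hs)) (S.weight_pos ht0)
    _ ≤ (betaPow h k μ ν a b ε q t)⁻¹ / h t ^ a * h t ^ a :=
        mul_le_mul_of_nonneg_right (S.inv_betaPow_div_mono hs ht) (S.weight_pos ht0).le
    _ = _ := div_mul_cancel₀ _ (S.weight_pos ht0).ne'

/-- Comparison at time `s₂` of two decaying solutions started over `Z_β` at times `s₁ ≤ s₂`. -/
theorem norm_compl_sub_le_of_isDecaying (S : IsAdmissible T P h k μ ν a b ε K q)
    (hg : IsSuperlinear g c q) (hc : 0 ≤ c) (hcK : 8 * (K * (K + 1)) * (c * (4 * K) ^ q) ≤ 1)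
    {s₁ s₂ : ℝ} {x₁ x₂ : ℝ → X} (hs : s₁ ≤ s₂)
    (h₁ : IsDecaying T g h a s₁ (4 * radius h k μ ν a b ε K q s₁) x₁)
    (h₂ : IsDecaying T g h a s₂ (4 * radius h k μ ν a b ε K q s₂) x₂) :
    ‖compl P s₂ (x₁ s₂) - compl P s₂ (x₂ s₂)‖
      ≤ 2 * (K * μ s₂ ^ ε) * ‖P s₂ (x₁ s₂) - P s₂ (x₂ s₂)‖ := by
  have hs₁ := h₁.mild.nonneg
  have := (S.norm_sub_le_of_isDecaying hg hc (h₁.restrict hs) h₂ (S.small_of_le hc hcK hs₁ hs)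
    (S.small_of_le hc hcK h₂.mild.nonneg le_rfl) le_rfl (e := 0) (by simp) rfl le_rfl).2.2.2
  refine this.trans_eq ?_
  have := (S.weight_pos h₂.mild.nonneg).ne'
  field_simp
  ring

theorem continuousOn_invariantMap (S : IsAdmissible T P h k μ ν a b ε K q)
    (hg : IsSuperlinear g c q) (hc : 0 ≤ c) (hcK : 8 * (K * (K + 1)) * (c * (4 * K) ^ q) ≤ 1) :
    ContinuousOn (fun p : ℝ × X =>
      invariantMap T P g h a (fun r => 4 * radius h k μ ν a b ε K q r) p.1 p.2)
      (ZBeta P h k μ ν a b ε q) := by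
  set Z := ZBeta P h k μ ν a b ε q with hZ
  set Φ := invariantMap T P g h a (fun r => 4 * radius h k μ ν a b ε K q r) with hΦ
  have hex : ∀ p : ℝ × X, p ∈ Z → ∃ x, IsDecaying T g h a p.1 (4 * radius h k μ ν a b ε K q p.1) x ∧
      P p.1 (x p.1) = p.2 := fun p hp => S.exists_isDecaying_of_mem hg hc hcK hp
  choose! x hx hxP using hex
  have hxQ : ∀ p ∈ Z, Φ p.1 p.2 = compl P p.1 (x p p.1) := by
    intro p hp
    have hmem : (p.1, P p.1 (x p p.1)) ∈ Z := by rw [hxP p hp]; exact hp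
    rw [← S.invariantMap_radius_eq hg hc hcK (hx p hp)
      (S.small_of_le hc hcK (hx p hp).mild.nonneg le_rfl) hmem, hxP p hp]
  intro p₀ hp₀
  obtain ⟨s₀, ξ₀⟩ := p₀
  have hs₀ : 0 ≤ s₀ := hp₀.1
  set x₀ := x (s₀, ξ₀) with hx₀
  have hfst : ∀ A : Set (ℝ × X), Tendsto (fun p : ℝ × X => p.1) (𝓝[A] (s₀, ξ₀)) (𝓝 s₀) :=
    fun A => continuous_fst.continuousAt.tendsto.mono_left nhdsWithin_le_nhds
  have hsnd : ∀ A : Set (ℝ × X), Tendsto (fun p : ℝ × X => p.2) (𝓝[A] (s₀, ξ₀)) (𝓝 ξ₀) :=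
    fun A => continuous_snd.continuousAt.tendsto.mono_left nhdsWithin_le_nhds
  -- the cases of later and of earlier base points are treated separately
  have hlater : ContinuousWithinAt (fun p : ℝ × X => Φ p.1 p.2) (Z ∩ {p | s₀ ≤ p.1}) (s₀, ξ₀) := by
    set A := Z ∩ {p : ℝ × X | s₀ ≤ p.1} with hA
    have hfst' : Tendsto (fun p : ℝ × X => p.1) (𝓝[A] (s₀, ξ₀)) (𝓝[Ici s₀] s₀) :=
      tendsto_nhdsWithin_iff.2 ⟨hfst A, eventually_nhdsWithin_of_forall fun p hp => hp.2⟩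
    have hcx : ContinuousOn x₀ (Ici s₀) := (hx _ hp₀).mild.continuousOn
    have hcP : ContinuousOn (fun t => P t (x₀ t)) (Ici s₀) :=
      (S.continuousOn_proj.mono (Ici_subset_Ici.2 hs₀)).clm_apply hcx
    have hcQ : ContinuousOn (fun t => compl P t (x₀ t)) (Ici s₀) :=
      (S.continuousOn_compl.mono (Ici_subset_Ici.2 hs₀)).clm_apply hcx
    have hP : Tendsto (fun p : ℝ × X => P p.1 (x₀ p.1)) (𝓝[A] (s₀, ξ₀)) (𝓝 ξ₀) := by
      have := (hcP s₀ self_mem_Ici).tendsto.comp hfst'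
      rwa [hxP _ hp₀] at this
    have hQ : Tendsto (fun p : ℝ × X => compl P p.1 (x₀ p.1)) (𝓝[A] (s₀, ξ₀)) (𝓝 (Φ s₀ ξ₀)) := by
      have := (hcQ s₀ self_mem_Ici).tendsto.comp hfst'
      rwa [← hxQ _ hp₀] at this
    have hdiff : Tendsto (fun p : ℝ × X => compl P p.1 (x₀ p.1) - Φ p.1 p.2) (𝓝[A] (s₀, ξ₀))
        (𝓝 0) := by
      have hlim : Tendsto (fun p : ℝ × X => 2 * (K * μ (s₀ + 1) ^ ε) * ‖P p.1 (x₀ p.1) - p.2‖)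
          (𝓝[A] (s₀, ξ₀)) (𝓝 0) := by
        simpa using ((hP.sub (hsnd A)).norm).const_mul (2 * (K * μ (s₀ + 1) ^ ε))
      refine squeeze_zero_norm' ?_ hlim
      filter_upwards [self_mem_nhdsWithin, (hfst A).eventually (gt_mem_nhds (lt_add_one s₀))]
        with p hp hp1
      have hp0 : 0 ≤ p.1 := hp.1.1
      have h1 := S.norm_compl_sub_le_of_isDecaying hg hc hcK hp.2 (hx _ hp₀) (hx _ hp.1)
      rw [hxP p hp.1, ← hxQ p hp.1] at h1
      refine h1.trans (mul_le_mul_of_nonneg_right ?_ (norm_nonneg _))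
      have h2 : μ p.1 ^ ε ≤ μ (s₀ + 1) ^ ε := Real.rpow_le_rpow (S.rate_μ.pos _ hp0).le
        (S.rate_μ.monotoneOn hp0 (hp0.trans hp1.le) hp1.le) S.dich.ε_nonneg
      have := mul_le_mul_of_nonneg_left h2 S.K_pos.le
      linarith
    have := hQ.sub hdiff
    simpa [ContinuousWithinAt] using this
  have hearlier : ContinuousWithinAt (fun p : ℝ × X => Φ p.1 p.2) (Z ∩ {p | p.1 ≤ s₀})
      (s₀, ξ₀) := by
    set A := Z ∩ {p : ℝ × X | p.1 ≤ s₀} with hA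
    have hfst' : Tendsto (fun p : ℝ × X => p.1) (𝓝[A] (s₀, ξ₀)) (𝓝[Ici 0] s₀) :=
      tendsto_nhdsWithin_iff.2 ⟨hfst A, eventually_nhdsWithin_of_forall fun p hp => hp.1.1⟩
    set I : ℝ × X → X := fun p => ∫ τ in p.1..s₀, T s₀ τ (g τ (x p τ)) with hI
    obtain ⟨M, hM0, hM⟩ := S.evol.exists_bound s₀
    set R := 4 * radius h k μ ν a b ε K q s₀ with hR
    have hR0 : 0 ≤ R := mul_nonneg (by norm_num) (S.radius_pos hs₀).le
    have hI0 : Tendsto I (𝓝[A] (s₀, ξ₀)) (𝓝 0) := by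
      have hlim : Tendsto (fun p : ℝ × X => M * (c * R * R ^ q) * |s₀ - p.1|) (𝓝[A] (s₀, ξ₀))
          (𝓝 0) := by
        simpa using ((tendsto_const_nhds (x := s₀)).sub (hfst A)).abs.const_mul
          (M * (c * R * R ^ q))
      refine squeeze_zero_norm' ?_ hlim
      filter_upwards [self_mem_nhdsWithin] with p hp
      have hp0 : 0 ≤ p.1 := hp.1.1
      refine intervalIntegral.norm_integral_le_of_norm_le_const fun τ hτ => ?_
      rw [uIoc_of_le hp.2] at hτ
      have hτ0 : 0 ≤ τ := hp0.trans hτ.1.le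
      have hxR : ‖x p τ‖ ≤ R := by
        have h2 : 0 ≤ 4 * radius h k μ ν a b ε K q p.1 :=
          mul_nonneg (by norm_num) (S.radius_pos hp0).le
        have h3 := S.radius_mono hp0 hp.2
        calc ‖x p τ‖ ≤ 4 * radius h k μ ν a b ε K q p.1 * h τ ^ a := (hx p hp.1).bound τ hτ.1.le
          _ ≤ 4 * radius h k μ ν a b ε K q p.1 := mul_le_of_le_one_right h2 (S.weight_le_one hτ0)
          _ ≤ R := by rw [hR]; linarith
      refine (T s₀ τ).le_of_opNorm_le_of_le (hM s₀ ⟨hs₀, le_rfl⟩ τ ⟨hτ0, hτ.2⟩) ?_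
      refine (hg.norm_le S.q_pos hτ0 _).trans ?_
      have := S.q_pos
      gcongr
    have hstep : ∀ p ∈ A, x p s₀ = T s₀ p.1 (x p p.1) + I p := fun p hp =>
      (hx p hp.1).mild.eq p.1 s₀ le_rfl hp.2
    have hPstep : ∀ p ∈ A, P s₀ (x p s₀) = T s₀ p.1 p.2 + P s₀ (I p) := fun p hp => by
      rw [hstep p hp, map_add, S.proj_evol hs₀ hp.1.1, hxP p hp.1]
    have hQstep : ∀ p ∈ A, compl P s₀ (x p s₀) = T s₀ p.1 (Φ p.1 p.2) + compl P s₀ (I p) :=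
      fun p hp => by rw [hstep p hp, map_add, S.compl_evol hs₀ hp.1.1, hxQ p hp.1]
    have hT1 : Tendsto (fun p : ℝ × X => T s₀ p.1) (𝓝[A] (s₀, ξ₀))
        (𝓝 (ContinuousLinearMap.id ℝ X)) := by
      have := (S.evol.continuousOn_snd hs₀ s₀ hs₀).tendsto.comp hfst'
      rwa [S.evol.self s₀ hs₀] at this
    have hT2 : Tendsto (fun p : ℝ × X => T p.1 s₀) (𝓝[A] (s₀, ξ₀))
        (𝓝 (ContinuousLinearMap.id ℝ X)) := by
      have := (S.evol.continuousOn_fst hs₀ s₀ hs₀).tendsto.comp hfst'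
      rwa [S.evol.self s₀ hs₀] at this
    have hP : Tendsto (fun p => P s₀ (x p s₀)) (𝓝[A] (s₀, ξ₀)) (𝓝 ξ₀) := by
      have h1 := ((isBoundedBilinearMap_apply.continuous.tendsto
        (ContinuousLinearMap.id ℝ X, ξ₀)).comp (hT1.prodMk_nhds (hsnd A))).add
        (((P s₀).continuous.tendsto 0).comp hI0)
      simp only [map_zero, add_zero] at h1
      exact h1.congr' (eventually_nhdsWithin_of_forall fun p hp => (hPstep p hp).symm)
    have hQ : Tendsto (fun p => compl P s₀ (x p s₀)) (𝓝[A] (s₀, ξ₀)) (𝓝 (Φ s₀ ξ₀)) := by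
      have hlim : Tendsto (fun p => 2 * (K * μ s₀ ^ ε) * ‖P s₀ (x p s₀) - ξ₀‖)
          (𝓝[A] (s₀, ξ₀)) (𝓝 0) := by
        simpa using ((hP.sub_const ξ₀).norm).const_mul (2 * (K * μ s₀ ^ ε))
      refine tendsto_iff_norm_sub_tendsto_zero.2 (squeeze_zero' (Eventually.of_forall fun _ =>
        norm_nonneg _) ?_ hlim)
      filter_upwards [self_mem_nhdsWithin] with p hp
      have h1 := S.norm_compl_sub_le_of_isDecaying hg hc hcK hp.2 (hx _ hp.1) (hx _ hp₀)
      rwa [hxP _ hp₀, ← hxQ _ hp₀] at h1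
    have h2 := (isBoundedBilinearMap_apply.continuous.tendsto
      (ContinuousLinearMap.id ℝ X, Φ s₀ ξ₀ - compl P s₀ 0)).comp
        (hT2.prodMk_nhds (hQ.sub (((compl P s₀).continuous.tendsto 0).comp hI0)))
    simp only [map_zero, sub_zero] at h2
    refine h2.congr' (eventually_nhdsWithin_of_forall fun p hp => ?_)
    simp only [Function.comp_apply]
    rw [hQstep p hp, add_sub_cancel_right, S.evol.comp_apply hp.1.1 hs₀ hp.1.1,
      S.evol.self_apply hp.1.1]
  refine (hlater.union hearlier).mono fun p hp => ?_
  rcases le_total s₀ p.1 with h1 | h1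
  · exact Or.inl ⟨hp, h1⟩
  · exact Or.inr ⟨hp, h1⟩

theorem isGraphFunction_invariantMap (S : IsAdmissible T P h k μ ν a b ε K q)
    (hg : IsSuperlinear g c q) (hc : 0 ≤ c) (hcK : 8 * (K * (K + 1)) * (c * (4 * K) ^ q) ≤ 1) :
    IsGraphFunction P (ZBeta P h k μ ν a b ε q)
      (invariantMap T P g h a fun r => 4 * radius h k μ ν a b ε K q r) := by
  have hK := S.K_pos
  refine ⟨S.continuousOn_invariantMap hg hc hcK, fun s hs => ?_, fun s ξ _ => ?_,
    fun s ξ₁ ξ₂ h₁ h₂ => ?_⟩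
  · have := S.invariantMap_radius_eq hg hc hcK (S.isDecaying_zero hg hs)
      (by rw [Real.zero_rpow S.q_pos.ne']; norm_num) (by simpa using S.zero_mem_ZBeta hs)
    simpa using this
  · unfold invariantMap
    split_ifs with H
    · exact ⟨_, rfl⟩
    · exact ⟨0, map_zero _⟩
  · have hs : 0 ≤ s := h₁.1
    obtain ⟨x₁, hx₁, rfl⟩ := S.exists_isDecaying_of_mem hg hc hcK h₁
    obtain ⟨x₂, hx₂, rfl⟩ := S.exists_isDecaying_of_mem hg hc hcK h₂
    have hsm := S.small_of_le hc hcK hs le_rfl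
    rw [S.invariantMap_radius_eq hg hc hcK hx₁ hsm h₁, S.invariantMap_radius_eq hg hc hcK hx₂ hsm h₂]
    have h3 := (S.norm_sub_le_of_isDecaying hg hc hx₁ hx₂ hsm hsm le_rfl (e := 0) (by simp) rfl
      le_rfl).2.2.1
    refine h3.trans ?_
    have hH := S.weight_pos hs
    have hM := S.one_le_μ_rpow hs
    have hC := (S.tailC_pos hs).le
    set R := (4 * radius h k μ ν a b ε K q s) ^ q with hR
    have hR0 : 0 ≤ R := Real.rpow_nonneg (mul_nonneg (by norm_num) (S.radius_pos hs).le) _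
    set d := ‖P s (x₁ s) - P s (x₂ s)‖ with hd
    have hd0 : 0 ≤ d := norm_nonneg _
    have h4 := S.small_mul hc hcK hs
    rw [← hR] at h4
    have h5 : 0 ≤ c * R * tailC h μ ν a ε q s * μ s ^ ε := mul_nonneg (by positivity) (by linarith)
    calc K * (c * (R + R) * (2 * (K * μ s ^ ε * d / h s ^ a) + 4 * (K * 0 * tailC h μ ν a ε q s))
          + 0) * tailC h μ ν a ε q s * h s ^ a
        = 4 * (K * K) * (c * R * tailC h μ ν a ε q s * μ s ^ ε) * d := by field_simp; ring
      _ ≤ 1 * d := by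
          refine mul_le_mul_of_nonneg_right ?_ hd0
          nlinarith [mul_nonneg hK.le h5, mul_nonneg (mul_nonneg hK.le hK.le) h5]
      _ = d := one_mul d

theorem isForwardInvariant_invariantMap (S : IsAdmissible T P h k μ ν a b ε K q)
    (hg : IsSuperlinear g c q) (hc : 0 ≤ c) (hcK : 8 * (K * (K + 1)) * (c * (4 * K) ^ q) ≤ 1) :
    IsForwardInvariant T P g (ZBeta P h k μ ν a b ε q) (ZBetaMu P h k μ ν a b ε q (2 * K))
      (invariantMap T P g h a fun r => 4 * radius h k μ ν a b ε K q r) := by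
  intro s ξ hξ κ hκ
  have hs : 0 ≤ s := hξ.1
  have hξ' := S.ZBetaMu_subset_ZBeta hξ
  obtain ⟨x, hx, rfl⟩ := S.exists_isDecaying_of_mem hg hc hcK hξ'
  have hsκ : s ≤ s + κ := by linarith
  have hmem := S.proj_mem_ZBeta hg hc hx (S.small_of_le hc hcK hs le_rfl) hξ hsκ
  refine ⟨(s + κ, P (s + κ) (x (s + κ)), compl P (s + κ) (x (s + κ))), ?_, hmem, ?_⟩
  · rw [S.invariantMap_radius_eq hg hc hcK hx (S.small_of_le hc hcK hs le_rfl) hξ']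
    exact S.semiflow_of_isMild hx.mild hκ
  · exact (S.invariantMap_radius_eq hg hc hcK (hx.restrict hsκ) (S.small_of_le hc hcK hs hsκ)
      hmem).symm

/-- Any forward invariant graph consists of decaying solutions, so it is the graph of
`invariantMap`. -/
theorem eq_invariantMap_of_isForwardInvariant (S : IsAdmissible T P h k μ ν a b ε K q)
    (hg : IsSuperlinear g c q) (hc : 0 ≤ c) (hcK : 8 * (K * (K + 1)) * (c * (4 * K) ^ q) ≤ 1)
    {Φ : ℝ → X → X} (hΦ : IsGraphFunction P (ZBeta P h k μ ν a b ε q) Φ)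
    (hinv : IsForwardInvariant T P g (ZBeta P h k μ ν a b ε q)
      (ZBetaMu P h k μ ν a b ε q (2 * K)) Φ) {s : ℝ} {ξ : X}
    (hξ : (s, ξ) ∈ ZBetaMu P h k μ ν a b ε q (2 * K)) :
    Φ s ξ = invariantMap T P g h a (fun r => 4 * radius h k μ ν a b ε K q r) s ξ := by
  have hs : 0 ≤ s := hξ.1
  have hξ' := S.ZBetaMu_subset_ZBeta hξ
  obtain ⟨x, hx, hxs⟩ := S.evol.exists_isMild_of_forall hg S.q_pos hc hs (ξ + Φ s ξ) (by
    intro κ hκ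
    obtain ⟨p, ⟨-, -, u, v, huv, hp, -⟩, -⟩ := hinv s ξ hξ κ hκ
    simp only [Prod.mk.injEq, true_and] at hp huv
    refine ⟨fun t => u t + v t, huv.continuousOn_u.add huv.continuousOn_v, fun r hr => ?_⟩
    rw [hp.2, hp.1]
    exact S.add_eq_of_isSplitSolution hg hs huv r hr)
  have hon : ∀ t, s ≤ t → (t, P t (x t)) ∈ ZBeta P h k μ ν a b ε q ∧
      compl P t (x t) = Φ t (P t (x t)) := by
    intro t ht
    obtain ⟨p, hp, hpg⟩ := hinv s ξ hξ (t - s) (sub_nonneg.2 ht)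
    have := S.eq_of_semiflow hg hc hx hxs.symm hp
    rw [add_sub_cancel] at this
    rw [this] at hpg
    exact hpg
  have hP : P s (x s) = ξ := by
    rw [hxs, map_add, (S.dich.mem_stableSpace_iff hs).1 hξ.2.1,
      (S.dich.mem_unstableSpace_iff hs).1 (hΦ.mem_unstable s ξ hξ'), add_zero]
  have hdom : ∀ t, s ≤ t → ‖x t‖ ≤ 2 * ‖P t (x t)‖ := by
    intro t ht
    have ht0 := hs.trans ht
    obtain ⟨h1, h2⟩ := hon t ht
    have h3 := hΦ.lipschitz t _ _ h1 (S.zero_mem_ZBeta ht0)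
    rw [hΦ.map_zero t ht0, sub_zero, sub_zero, ← h2] at h3
    calc ‖x t‖ = ‖P t (x t) + compl P t (x t)‖ := by rw [add_compl_apply]
      _ ≤ ‖P t (x t)‖ + ‖compl P t (x t)‖ := norm_add_le _ _
      _ ≤ 2 * ‖P t (x t)‖ := by linarith
  have hM := zero_lt_one.trans_le (S.one_le_μ_rpow hs)
  have hsm := S.small_of_le hc hcK hs le_rfl
  have hdec : IsDecaying T g h a s (4 * radius h k μ ν a b ε K q s) x := by
    refine ⟨hx, fun t ht => (hdom t ht).trans ?_⟩
    have := S.norm_proj_le_of_dominated hg hc hx (S.radius_pos hs) hdom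
      (by rw [hP]; exact div_le_div_of_nonneg_right (mul_le_mul_of_nonneg_left hξ'.2.2.le
            (mul_nonneg S.K_pos.le hM.le)) (S.weight_pos hs).le) hsm ht
    linarith
  have h1 := S.invariantMap_radius_eq hg hc hcK hdec hsm (by rw [hP]; exact hξ')
  rw [hP] at h1
  rw [h1, (hon s le_rfl).2, hP]

/-- The semiflow over `Z_{βμ}(2K)` on the invariant graph is the flow along decaying solutions. -/
theorem exists_isDecaying_semiflow_eq (S : IsAdmissible T P h k μ ν a b ε K q)
    (hg : IsSuperlinear g c q) (hc : 0 ≤ c) (hcK : 8 * (K * (K + 1)) * (c * (4 * K) ^ q) ≤ 1)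
    {s : ℝ} {ξ : X} (hξ : (s, ξ) ∈ ZBetaMu P h k μ ν a b ε q (2 * K)) :
    ∃ x, IsDecaying T g h a s (4 * radius h k μ ν a b ε K q s) x ∧ P s (x s) = ξ ∧
      ∀ κ p, Semiflow T P g κ (s, ξ, invariantMap T P g h a
        (fun r => 4 * radius h k μ ν a b ε K q r) s ξ) p →
        p = (s + κ, P (s + κ) (x (s + κ)), compl P (s + κ) (x (s + κ))) := by
  have hξ' := S.ZBetaMu_subset_ZBeta hξ
  obtain ⟨x, hx, rfl⟩ := S.exists_isDecaying_of_mem hg hc hcK hξ'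
  refine ⟨x, hx, rfl, fun κ p hp => S.eq_of_semiflow hg hc hx.mild ?_ hp⟩
  rw [S.invariantMap_radius_eq hg hc hcK hx (S.small_of_le hc hcK hξ.1 le_rfl) hξ',
    add_compl_apply]

end Graph

end IsAdmissible

/-- The norm of a difference of two points of the phase space at the same time. -/
theorem norm_sub_prod_le {E : Type*} [NormedAddCommGroup E] {t D : ℝ} {x₁ x₂ y₁ y₂ : E} (hx : ‖x₁ - x₂‖ ≤ D) (hy : ‖y₁ - y₂‖ ≤ D) :
    ‖((t, x₁, y₁) : ℝ × E × E) - (t, x₂, y₂)‖ ≤ D := by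
  simp only [Prod.mk_sub_mk, sub_self, Prod.norm_mk, norm_zero]
  exact max_le ((norm_nonneg _).trans hx) (max_le hx hy)

theorem IsPerturbation.isSuperlinear {E V : Type*} [NormedAddCommGroup E] [NormedAddCommGroup V]
    {Y : Set V} {f : ℝ → E → V → E} {c q : ℝ} (hf : IsPerturbation Y f c q) {lam : V} (hlam : lam ∈ Y) :
    IsSuperlinear (fun t x => f t x lam) c q :=
  ⟨fun x => hf.continuousOn x lam hlam, fun t ht => hf.map_zero t ht lam hlam,
    fun t ht x₁ x₂ => hf.lipschitz t ht x₁ x₂ lam hlam⟩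

end StableManifold

end

/-! ### The stable manifold and its dependence on the parameter -/

theorem mainTheorem3 {X : Type*} [NormedAddCommGroup X] [NormedSpace ℝ X] [CompleteSpace X]
    (A : ℝ → X →L[ℝ] X) (hA : ContinuousOn A (Set.Ici 0))
    (T : ℝ → ℝ → X →L[ℝ] X) (hT : StableManifold.IsEvolutionOperator A T)
    (h k μ ν : ℝ → ℝ)
    (hh : StableManifold.IsGrowthRate h) (hk : StableManifold.IsGrowthRate k)
    (hμ : StableManifold.IsGrowthRate μ) (hν : StableManifold.IsGrowthRate ν)
    (P : ℝ → X →L[ℝ] X) (a b ε K q : ℝ) (hq : 0 < q)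
    (hD : StableManifold.IsDichotomy T P h k μ ν a b ε K)
    (hC : MeasureTheory.IntegrableOn (StableManifold.tailIntegrand h μ ν a ε q) (Set.Ioi 0))
    (hlim : Filter.Tendsto (fun t => k t ^ (-b) * h t ^ a * ν t ^ ε) Filter.atTop (nhds 0))
    (hanti : AntitoneOn (fun t => h t ^ a * StableManifold.betaPow h k μ ν a b ε q t)
      (Set.Ici 0)) :
    ∃ c₀ : ℝ, 0 < c₀ ∧
      ∀ (V : Type*) [NormedAddCommGroup V] [NormedSpace ℝ V] [CompleteSpace V]
        (Y : Set V) (f : ℝ → X → V → X) (c : ℝ),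
        IsOpen Y → 0 < c → c ≤ c₀ → StableManifold.IsPerturbation Y f c q →
        ∃ Φ : V → ℝ → X → X,
          (∀ lam ∈ Y,
            StableManifold.IsGraphFunction P
                (StableManifold.ZBeta P h k μ ν a b ε q) (Φ lam) ∧
              StableManifold.IsForwardInvariant T P (fun t x => f t x lam)
                (StableManifold.ZBeta P h k μ ν a b ε q)
                (StableManifold.ZBetaMu P h k μ ν a b ε q (2 * K)) (Φ lam) ∧
              ∀ Φ' : ℝ → X → X,
                StableManifold.IsGraphFunction P
                    (StableManifold.ZBeta P h k μ ν a b ε q) Φ' →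
                StableManifold.IsForwardInvariant T P (fun t x => f t x lam)
                    (StableManifold.ZBeta P h k μ ν a b ε q)
                    (StableManifold.ZBetaMu P h k μ ν a b ε q (2 * K)) Φ' →
                ∀ s ξ, (s, ξ) ∈ StableManifold.ZBetaMu P h k μ ν a b ε q (2 * K) →
                  Φ' s ξ = Φ lam s ξ) ∧
          (∃ d : ℝ, 0 < d ∧ ∀ lam ∈ Y, ∀ s ξ₁ ξ₂,
            (s, ξ₁) ∈ StableManifold.ZBetaMu P h k μ ν a b ε q (2 * K) →
            (s, ξ₂) ∈ StableManifold.ZBetaMu P h k μ ν a b ε q (2 * K) →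
            ∀ κ, 0 ≤ κ → ∀ p₁ p₂ : ℝ × X × X,
              StableManifold.Semiflow T P (fun t x => f t x lam) κ (s, ξ₁, Φ lam s ξ₁) p₁ →
              StableManifold.Semiflow T P (fun t x => f t x lam) κ (s, ξ₂, Φ lam s ξ₂) p₂ →
              ‖p₁ - p₂‖ ≤ d * (h (s + κ) / h s) ^ a * μ s ^ ε * ‖ξ₁ - ξ₂‖) ∧
          (∃ d' : ℝ, 0 < d' ∧ ∀ lam₁ ∈ Y, ∀ lam₂ ∈ Y, ∀ s ξ,
            (s, ξ) ∈ StableManifold.ZBetaMu P h k μ ν a b ε q (2 * K) →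
            ∀ κ, 0 ≤ κ → ∀ p₁ p₂ : ℝ × X × X,
              StableManifold.Semiflow T P (fun t x => f t x lam₁) κ (s, ξ, Φ lam₁ s ξ) p₁ →
              StableManifold.Semiflow T P (fun t x => f t x lam₂) κ (s, ξ, Φ lam₂ s ξ) p₂ →
              ‖p₁ - p₂‖ ≤
                d' * (h (s + κ) / h s) ^ a * μ s ^ ε * ‖lam₁ - lam₂‖ * ‖ξ‖) := by
  have S : StableManifold.IsAdmissible T P h k μ ν a b ε K q :=
    ⟨hT.isEvolutionFamily hA, hh, hk, hμ, hν, hq, hD, hC, hlim, hanti⟩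
  have hK := hD.K_pos
  have hD0 : 0 < 8 * (K * (K + 1)) * (4 * K) ^ q := by positivity
  refine ⟨(8 * (K * (K + 1)) * (4 * K) ^ q)⁻¹, inv_pos.2 hD0, ?_⟩
  intro V _ _ _ Y f c _ hc0 hcle hf
  have hc := hc0.le
  have hcK : 8 * (K * (K + 1)) * (c * (4 * K) ^ q) ≤ 1 := by
    have := mul_le_mul_of_nonneg_left hcle hD0.le
    rw [mul_inv_cancel₀ hD0.ne'] at this
    linarith
  refine ⟨fun lam => StableManifold.invariantMap T P (fun t x => f t x lam) h a
    fun r => 4 * StableManifold.radius h k μ ν a b ε K q r, fun lam hlam => ?_,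
    ⟨2 * K, by positivity, ?_⟩, ⟨K, hK, ?_⟩⟩
  · have hg := hf.isSuperlinear hlam
    exact ⟨S.isGraphFunction_invariantMap hg hc hcK, S.isForwardInvariant_invariantMap hg hc hcK,
      fun Φ' hΦ' hinv s ξ hξ => S.eq_invariantMap_of_isForwardInvariant hg hc hcK hΦ' hinv hξ⟩
  · intro lam hlam s ξ₁ ξ₂ hξ₁ hξ₂ κ hκ p₁ p₂ hp₁ hp₂
    have hg := hf.isSuperlinear hlam
    have hs : 0 ≤ s := hξ₁.1
    have ht : s ≤ s + κ := by linarith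
    obtain ⟨x₁, hx₁, hx₁P, hx₁p⟩ := S.exists_isDecaying_semiflow_eq hg hc hcK hξ₁
    obtain ⟨x₂, hx₂, hx₂P, hx₂p⟩ := S.exists_isDecaying_semiflow_eq hg hc hcK hξ₂
    rw [hx₁p κ p₁ hp₁, hx₂p κ p₂ hp₂]
    have hsm := S.small_of_le hc hcK hs le_rfl
    have key := S.norm_sub_le_of_isDecaying hg hc hx₁ hx₂ hsm hsm le_rfl (e := 0) (by simp) rfl ht
    rw [hx₁P, hx₂P] at key
    rw [Real.div_rpow (hh.pos _ (hs.trans ht)).le (hh.pos s hs).le]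
    refine (StableManifold.norm_sub_prod_le key.2.1 key.2.2.2).trans_eq ?_
    ring
  · intro lam₁ hlam₁ lam₂ hlam₂ s ξ hξ κ hκ p₁ p₂ hp₁ hp₂
    have hg₁ := hf.isSuperlinear hlam₁
    have hg₂ := hf.isSuperlinear hlam₂
    have hs : 0 ≤ s := hξ.1
    have ht : s ≤ s + κ := by linarith
    obtain ⟨x₁, hx₁, hx₁P, hx₁p⟩ := S.exists_isDecaying_semiflow_eq hg₁ hc hcK hξ
    obtain ⟨x₂, hx₂, hx₂P, hx₂p⟩ := S.exists_isDecaying_semiflow_eq hg₂ hc hcK hξ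
    rw [hx₁p κ p₁ hp₁, hx₂p κ p₂ hp₂]
    have hsm := S.small_of_le hc hcK hs le_rfl
    have hM := zero_lt_one.trans_le (S.one_le_μ_rpow hs)
    have hH := S.weight_pos hs
    have hR := S.radius_pos hs
    have hC0 := (S.tailC_pos hs).le
    -- `m` is the sharp weighted size of `x₂`, proportional to `‖ξ‖`
    set m := 2 * (K * μ s ^ ε * ‖ξ‖ / h s ^ a) with hm
    have hm0 : 0 ≤ m := by positivity
    have hx₂m : ∀ t, s ≤ t → ‖x₂ t‖ ≤ m * h t ^ a := fun t ht => by
      have := (S.norm_proj_le_of_isDecaying hg₂ hc hx₂ hsm ht).1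
      rwa [hx₂P] at this
    have hmR : m ≤ 4 * StableManifold.radius h k μ ν a b ε K q s := by
      have : K * μ s ^ ε * ‖ξ‖ / h s ^ a ≤ StableManifold.radius h k μ ν a b ε K q s :=
        div_le_div_of_nonneg_right (mul_le_mul_of_nonneg_left (S.ZBetaMu_subset_ZBeta hξ).2.2.le
          (mul_nonneg hK.le hM.le)) hH.le
      linarith
    set R := (4 * StableManifold.radius h k μ ν a b ε K q s) ^ q with hRdef
    have hR0 : 0 ≤ R := by positivity
    have he : 0 ≤ c * ‖lam₁ - lam₂‖ * (m * R) := by positivity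
    have key := S.norm_sub_le_of_isDecaying hg₁ hc hx₁ hx₂ hsm hsm he (fun t ht => by
      have hpt := S.weight_pos (hs.trans ht)
      have hxn : ‖x₂ t‖ ^ q ≤ R * (h t ^ a) ^ q := by
        rw [hRdef, ← Real.mul_rpow (by positivity) hpt.le]
        exact Real.rpow_le_rpow (norm_nonneg _) (hx₂.bound t ht) hq.le
      have hxs : ‖x₂ t‖ ^ (q + 1) = ‖x₂ t‖ * ‖x₂ t‖ ^ q := by
        rw [Real.rpow_add_one' (norm_nonneg _) (by positivity), mul_comm]
      calc ‖f t (x₂ t) lam₁ - f t (x₂ t) lam₂‖ ≤ c * ‖lam₁ - lam₂‖ * ‖x₂ t‖ ^ (q + 1) :=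
            hf.lipschitz_param t (hs.trans ht) _ _ hlam₁ _ hlam₂
        _ ≤ c * ‖lam₁ - lam₂‖ * (m * h t ^ a * (R * (h t ^ a) ^ q)) := by
            rw [hxs]
            have := hx₂m t ht
            gcongr
        _ = _ := by ring) rfl ht
    rw [hx₁P, hx₂P, sub_self, norm_zero, mul_zero, zero_div, mul_zero, zero_add] at key
    rw [Real.div_rpow (hh.pos _ (hs.trans ht)).le (hh.pos s hs).le]
    refine (StableManifold.norm_sub_prod_le key.2.1 key.2.2.2).trans ?_
    have hpt := S.weight_pos (hs.trans ht)
    calc 4 * (K * (c * ‖lam₁ - lam₂‖ * (m * R)) * StableManifold.tailC h μ ν a ε q s)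
          * h (s + κ) ^ a
        = 4 * (K * c * R * StableManifold.tailC h μ ν a ε q s)
          * (‖lam₁ - lam₂‖ * m * h (s + κ) ^ a) := by ring
      _ ≤ 1 / 2 * (‖lam₁ - lam₂‖ * m * h (s + κ) ^ a) :=
          mul_le_mul_of_nonneg_right hsm (by positivity)
      _ = K * (h (s + κ) ^ a / h s ^ a) * μ s ^ ε * ‖lam₁ - lam₂‖ * ‖ξ‖ := by rw [hm]; ring
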